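/- **Setting.** Keys and blocks are bit strings of fixed lengths $\kappa,\ell$. An IBLT has $m$ cells, each with fields keySum, valueSum, tagSum, initially $0$. $\mathsf{Update}(\mathbf T,(k,b),t)$ XORs $(k,b,t)$ into the $q$ distinct cells $h_1(k),\dots,h_q(k)$; $\mathsf{Combine}$ is cellwise XOR. $\mathsf{Peel}(\mathbf T)$ repeatedly chooses a pure cell, outputs its content and removes it by $\mathsf{Update}$; it succeeds if it ends with the empty table. Let $N$ be a product of two distinct primes with exactly $2\tau$ bits, $e$ a prime, $de\equiv 1 \pmod{\varphi(N)}$, $g$ a generator of the group $\mathbf{QR}_N$ of quadratic residues; $pk=(N,e,(h_i),g,h)$, $sk=d$. The tag of $(k,b)$ is $T_k=(h(k)g^b)^d \bmod N$. A triple $(k,b,t)$ passes the public test if $t^e\equiv h(k)g^b \pmod N$. A cell is pure if its content passes this test (server) or has tagSum equal to the recomputed tag (client). The random choices are a uniformly random function $h$ from keys to $\mathbf{QR}_N$ and, independently, $q$ hash functions such that $k\mapsto(h_1(k),\dots,h_q(k))$ is a uniformly random function into $q$-tuples of distinct cells. **Construction.** $\mathsf{Setup}$: the client, with key set $K$, keeps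 $K$ and an IBLT $\mathbf T_B$ of all her triples $(k,b,T_k)$; the server stores the triples and builds an IBLT tree on a protected Cartesian tree with parameter $\beta$ and arbitrary priorities: a binary search tree on the keys with buckets at the leaves, whose every node has the IBLT of all triples below it. The pivot at an internal node is a key of smallest priority among the unprotected keys of its subtree (those with $\beta/2<\mathrm{rank}\le s-\beta/2$, where $s$ is the number of keys of the subtree and $\mathrm{rank}$ the number of smaller ones); a subtree without unprotected keys is a leaf. $\mathsf{Put}(k,b)$: both parties insert $(k,b,T_k)$. $\mathsf{ClientAudit}(K')$: from its tree the server builds the IBLT $\mathbf T_K$ of all blocks except those with keys in $K'$ and those that are missing or fail the public test ($\mathsf{ConstructIBLT}$); the client returns the key-block pairs given by $\mathsf{Peel}(\mathsf{Combine}(\mathbf T_B,\mathbf T_K))$, or $\mathtt{reject}$. $\mathsf{ServerAudit}(K')$: the same at the server, with the IBLT at the root of the tree in place of $\mathbf T_B$ (or $\mathtt{failure}$). $\mathsf{Get}(k)$: the server returns its block for $k$ if it passes the public test, and otherwise the block that $\mathsf{ServerAudit}(\{k\})$ gives, or $\mathtt{failure}$. $\mathsf{Delete}(k)$: after a successful $\mathsf{Get}(k)$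 both parties remove the triple of $k$. $\mathsf{AccountabilityChallenge}$: as $\mathsf{ClientAudit}$, with only missing or failing blocks left out of $\mathbf T_K$. **Theorem.** Let $q\ge 3$. There are constants $a, C$ that depend only on $q$ such that the following holds for all $\kappa,\ell,\tau,\beta$, all $\delta\ge 1$, all $m\ge a\delta$ (so an IBLT of size $O(\delta)$ suffices), all $(N,e,d,g)$ as above and all priorities. Put $$\varepsilon=\frac{C}{\delta^{\,q-2}}+\frac{C\,m}{4^{\tau}} .$$ Consider $\mathsf{Setup}$ on any initial data and any sequence of $\mathsf{Put}$s of new keys and $\mathsf{Delete}$s of existing keys. Let $K$ be the resulting set of keys and $(b_k)_{k\in K}$ the client's blocks. Let $L\subseteq K$, $|L|\le\delta$, and suppose that then the server's stored data for exactly the keys in $L$ is corrupted, i.e. is missing or fails the public test. The initial data, the sequence of operations, $L$, and $K^*$ and $k$ below are fixed independently of the random choices. Then each of the following events has probability at least $1-\varepsilon$ (the event being that the outcome is as stated for every order in which $\mathsf{Peel}$ chooses pure cells and for every content of the corrupted entries): 1. for each $K^*\subseteq K$ with $|K^*|\le\delta$: $\mathsf{ClientAudit}(K^*)$ outputs exactly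 the correct blocks $\{(j,b_j): j\in K^*\cup L\}$; and likewise for $\mathsf{ServerAudit}(K^*)$; 2. for each $k\in K$: $\mathsf{Get}(k)$ outputs $b_k$; and likewise the event that $\mathsf{Delete}(k)$ succeeds, the client's new state is the correct one for the data without $k$, and $k$ is removed from the server's tree and storage while its other keys and stored data are unchanged; 3. $\mathsf{AccountabilityChallenge}$ outputs exactly $\{(j,b_j): j\in L\}$. In particular, the construction is correct with success probabilities $1-1/\mathrm{poly}(\delta)$ as soon as the tags are long enough, namely $4^\tau\ge m\,\delta^{q-2}$. -/

import Mathlib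

namespace DAS

/-! ### Invertible Bloom lookup tables -/

/-- A cell of an IBLT.  Keys and blocks are bit strings of fixed lengths `κ` and `ℓ`; tags are
natural numbers, XORed through their binary expansions. -/
@[ext] structure Cell (κ ℓ : ℕ) where
  keySum : BitVec κ
  valueSum : BitVec ℓ
  tagSum : ℕ

/-- The fieldwise XOR of two cells. -/
def Cell.xor {κ ℓ : ℕ} (c c' : Cell κ ℓ) : Cell κ ℓ :=
  ⟨c.keySum ^^^ c'.keySum, c.valueSum ^^^ c'.valueSum, c.tagSum ^^^ c'.tagSum⟩

/-- An IBLT with `m` cells. -/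
abbrev IBLT (κ ℓ m : ℕ) : Type := Fin m → Cell κ ℓ

/-- The empty IBLT: every field of every cell is `0`. -/
def IBLT.empty (κ ℓ m : ℕ) : IBLT κ ℓ m := fun _ => ⟨0, 0, 0⟩

/-- The `q` hash functions: every key is mapped to `q` distinct cells. -/
abbrev HashFamily (κ q m : ℕ) : Type := BitVec κ → (Fin q ↪ Fin m)

/-- A key, a block and a tag. -/
abbrev Triple (κ ℓ : ℕ) : Type := BitVec κ × BitVec ℓ × ℕ

open Classical in
/-- `Update`: XOR the triple `(k, v, t)` into the `q` cells `h₁(k), …, h_q(k)`. -/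
noncomputable def update {κ ℓ q m : ℕ} (H : HashFamily κ q m) (T : IBLT κ ℓ m)
    (k : BitVec κ) (v : BitVec ℓ) (t : ℕ) : IBLT κ ℓ m :=
  fun c => if ∃ i, H k i = c then (T c).xor ⟨k, v, t⟩ else T c

/-- `Combine`: cellwise XOR. -/
def combine {κ ℓ m : ℕ} (T₁ T₂ : IBLT κ ℓ m) : IBLT κ ℓ m := fun c => (T₁ c).xor (T₂ c)

/-- A rule that resolves the free choice of a pure cell in `Peel`: given the current table and
the nonempty set of its pure cells, it picks one of them. -/
structure PeelRule (κ ℓ m : ℕ) where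
  pick : IBLT κ ℓ m → Finset (Fin m) → Fin m
  pick_mem : ∀ T s, s.Nonempty → pick T s ∈ s

open Classical in
/-- The cells of `T` that pass the purity test `isPure`. -/
noncomputable def pureCells {κ ℓ m : ℕ} (isPure : Cell κ ℓ → Prop) (T : IBLT κ ℓ m) :
    Finset (Fin m) :=
  Finset.univ.filter fun i => isPure (T i)

open Classical in
/-- One round of the loop of `Peel`, on the current table and the list of triples output so far.
Nothing changes when there is no pure cell. -/
noncomputable def peelStep {κ ℓ q m : ℕ} (H : HashFamily κ q m) (isPure : Cell κ ℓ → Prop)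
    (rule : PeelRule κ ℓ m) (s : IBLT κ ℓ m × List (Triple κ ℓ)) :
    IBLT κ ℓ m × List (Triple κ ℓ) :=
  if (pureCells isPure s.1).Nonempty then
    let c := s.1 (rule.pick s.1 (pureCells isPure s.1))
    (update H s.1 c.keySum c.valueSum c.tagSum, s.2 ++ [(c.keySum, c.valueSum, c.tagSum)])
  else s

open Classical in
/-- `Peel`: run the loop until there is no pure cell.  If the table is then empty, return the
triples that were output.  Otherwise, or if the loop never ends, this is a failure (`none`). -/
noncomputable def peel {κ ℓ q m : ℕ} (H : HashFamily κ q m) (isPure : Cell κ ℓ → Prop)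
    (rule : PeelRule κ ℓ m) (T : IBLT κ ℓ m) : Option (List (Triple κ ℓ)) :=
  if h : ∃ n, pureCells isPure ((peelStep H isPure rule)^[n] (T, [])).1 = ∅ then
    let s := (peelStep H isPure rule)^[Nat.find h] (T, [])
    if s.1 = IBLT.empty κ ℓ m then some s.2 else none
  else none

/-! ### RSA keys and tags -/

/-- The group of quadratic residues modulo `N`. -/
def QR (N : ℕ) : Subgroup (ZMod N)ˣ := (powMonoidHom 2 : (ZMod N)ˣ →* (ZMod N)ˣ).range

/-- The public key `(N, e, 𝓗, g, h)`.  The secret key is a number `d`. -/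
structure PublicKey (κ q m : ℕ) where
  N : ℕ
  e : ℕ
  hash : HashFamily κ q m
  g : QR N
  h : BitVec κ → QR N

/-- `N` is a product of two distinct primes and has exactly `2τ` bits, `e` is a prime,
`d e ≡ 1 (mod φ(N))`, and `g` generates the group of quadratic residues modulo `N`. -/
structure IsRSAKey (τ N e d : ℕ) (g : QR N) : Prop where
  factors : ∃ p p' : ℕ, p.Prime ∧ p'.Prime ∧ p ≠ p' ∧ N = p * p'
  lower : 2 ^ (2 * τ) ≤ 2 * N
  upper : N < 2 ^ (2 * τ)
  prime_e : e.Prime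
  inverse : d * e ≡ 1 [MOD N.totient]
  generator : ∀ x : QR N, x ∈ Subgroup.zpowers g

/-- The residue `h(k) g^b`. -/
def PublicKey.base {κ ℓ q m : ℕ} (pk : PublicKey κ q m) (k : BitVec κ) (b : BitVec ℓ) : QR pk.N :=
  pk.h k * pk.g ^ b.toNat

/-- The tag `(h(k) g^b)^d mod N`. -/
def tag {κ ℓ q m : ℕ} (pk : PublicKey κ q m) (sk : ℕ) (k : BitVec κ) (b : BitVec ℓ) : ℕ :=
  (((pk.base k b ^ sk : QR pk.N) : (ZMod pk.N)ˣ) : ZMod pk.N).val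

/-- The public test `t^e mod N = h(k) g^b mod N`. -/
def verify {κ ℓ q m : ℕ} (pk : PublicKey κ q m) (k : BitVec κ) (b : BitVec ℓ) (t : ℕ) : Prop :=
  (t : ZMod pk.N) ^ pk.e = ((pk.base k b : (ZMod pk.N)ˣ) : ZMod pk.N)

/-- The client's purity test, which recomputes the tag with the secret key. -/
def clientPure {κ ℓ q m : ℕ} (pk : PublicKey κ q m) (sk : ℕ) (c : Cell κ ℓ) : Prop :=
  tag pk sk c.keySum c.valueSum = c.tagSum

/-- The server's purity test, which uses the public exponent. -/
def serverPure {κ ℓ q m : ℕ} (pk : PublicKey κ q m) (c : Cell κ ℓ) : Prop :=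
  verify pk c.keySum c.valueSum c.tagSum

/-! ### The IBLT tree, based on the protected Cartesian tree -/

/-- What the server's storage holds under each key: a block and a tag, or nothing. -/
abbrev Store (κ ℓ : ℕ) : Type := BitVec κ → Option (BitVec ℓ × ℕ)

/-- The IBLT of the stored triples whose keys lie in `S`. -/
noncomputable def ibltOf {κ ℓ q m : ℕ} (H : HashFamily κ q m) (st : Store κ ℓ)
    (S : Finset (BitVec κ)) : IBLT κ ℓ m :=
  S.toList.foldl
    (fun T k => match st k with
      | some (b, t) => update H T k b t
      | none => T)
    (IBLT.empty κ ℓ m)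

/-- A binary search tree over keys with buckets at the leaves, one key at each internal node and
an IBLT at every node. -/
inductive IBLTTree (κ ℓ m : ℕ) : Type
  | leaf (T : IBLT κ ℓ m) (bucket : Finset (BitVec κ))
  | node (T : IBLT κ ℓ m) (left : IBLTTree κ ℓ m) (pivot : BitVec κ) (right : IBLTTree κ ℓ m)

/-- The IBLT at the root. -/
def IBLTTree.root {κ ℓ m : ℕ} : IBLTTree κ ℓ m → IBLT κ ℓ m
  | .leaf T _ => T
  | .node T _ _ _ => T

/-- The keys in the tree. -/
def IBLTTree.keys {κ ℓ m : ℕ} : IBLTTree κ ℓ m → Finset (BitVec κ)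
  | .leaf _ S => S
  | .node _ l p r => insert p (l.keys ∪ r.keys)

/-- The number of keys of `S` below `k`. -/
def rank {κ : ℕ} (S : Finset (BitVec κ)) (k : BitVec κ) : ℕ := (S.filter (· < k)).card

/-- The unprotected region: the keys `k` of `S` with `β/2 < rank k ≤ |S| - β/2`. -/
def unprotected {κ : ℕ} (β : ℕ) (S : Finset (BitVec κ)) : Finset (BitVec κ) :=
  S.filter fun k => β < 2 * rank S k ∧ 2 * rank S k + β ≤ 2 * S.card

/-- The pivot of `S`: an unprotected key of smallest priority, if there is an unprotected key. -/
noncomputable def pivot {κ : ℕ} (β : ℕ) (prio : BitVec κ → ℝ) (S : Finset (BitVec κ)) :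
    Option (BitVec κ) :=
  if h : (unprotected β S).Nonempty then
    some (Finset.exists_min_image (unprotected β S) prio h).choose
  else none

theorem pivot_mem {κ β : ℕ} {prio : BitVec κ → ℝ} {S : Finset (BitVec κ)} {p : BitVec κ}
    (h : pivot β prio S = some p) : p ∈ S := by
  unfold pivot at h
  split at h
  · rename_i hne
    have hp := (Finset.exists_min_image (unprotected β S) prio hne).choose_spec.1
    rw [Option.some.inj h] at hp
    exact (Finset.mem_filter.mp hp).1
  · exact absurd h (by simp)

/-- `InitIbltTree`. -/
noncomputable def initTree {κ ℓ q m : ℕ} (H : HashFamily κ q m) (β : ℕ) (prio : BitVec κ → ℝ)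
    (st : Store κ ℓ) (S : Finset (BitVec κ)) : IBLTTree κ ℓ m :=
  match h : pivot β prio S with
  | none => .leaf (ibltOf H st S) S
  | some p =>
    let l := initTree H β prio st (S.filter (· < p))
    let r := initTree H β prio st (S.filter (p < ·))
    .node (combine (combine l.root r.root) (ibltOf H st {p})) l p r
termination_by S.card
decreasing_by
  all_goals
    refine Finset.card_lt_card (Finset.filter_ssubset.mpr ⟨p, pivot_mem h, ?_⟩)
    exact BitVec.lt_irrefl p

/-- `InsertIbltTree` of the triple `(k, b, t)`; `st` is the storage that already contains it.
A subtree whose pivot changes is rebuilt. -/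
noncomputable def insertTree {κ ℓ q m : ℕ} (H : HashFamily κ q m) (β : ℕ) (prio : BitVec κ → ℝ)
    (st : Store κ ℓ) (k : BitVec κ) (b : BitVec ℓ) (t : ℕ) : IBLTTree κ ℓ m → IBLTTree κ ℓ m
  | .leaf _ S => initTree H β prio st (insert k S)
  | .node T l p r =>
    open Classical in
    if pivot β prio (insert k (IBLTTree.node T l p r).keys) = some p then
      if k < p then .node (update H T k b t) (insertTree H β prio st k b t l) p r
      else .node (update H T k b t) l p (insertTree H β prio st k b t r)
    else initTree H β prio st (insert k (IBLTTree.node T l p r).keys)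

/-- `DeleteIbltTree` of the triple `(k, b, t)`; `st` is the storage.  A subtree whose pivot
changes is rebuilt. -/
noncomputable def deleteTree {κ ℓ q m : ℕ} (H : HashFamily κ q m) (β : ℕ) (prio : BitVec κ → ℝ)
    (st : Store κ ℓ) (k : BitVec κ) (b : BitVec ℓ) (t : ℕ) : IBLTTree κ ℓ m → IBLTTree κ ℓ m
  | .leaf _ S => initTree H β prio st (S.erase k)
  | .node T l p r =>
    open Classical in
    if pivot β prio ((IBLTTree.node T l p r).keys.erase k) = some p then
      if k < p then .node (update H T k b t) (deleteTree H β prio st k b t l) p r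
      else .node (update H T k b t) l p (deleteTree H β prio st k b t r)
    else initTree H β prio st ((IBLTTree.node T l p r).keys.erase k)

/-- `ConstructIBLT`: the IBLT of the triples in the tree whose keys are not in `X`.  The IBLT of
a node is used as it is when no key below the node has to be left out. -/
noncomputable def constructIBLT {κ ℓ q m : ℕ} (H : HashFamily κ q m) (st : Store κ ℓ)
    (X : Finset (BitVec κ)) : IBLTTree κ ℓ m → IBLT κ ℓ m
  | .leaf T S => if Disjoint S X then T else ibltOf H st (S \ X)
  | .node T l p r =>
    if Disjoint (IBLTTree.node T l p r).keys X then T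
    else combine (combine (constructIBLT H st X l) (constructIBLT H st X r))
      (ibltOf H st ({p} \ X))

/-! ### The protocol -/

/-- The client's state: her set of keys and her IBLT. -/
structure Client (κ ℓ m : ℕ) where
  keys : Finset (BitVec κ)
  table : IBLT κ ℓ m

/-- The server's state: its storage and its IBLT tree. -/
structure Server (κ ℓ m : ℕ) where
  store : Store κ ℓ
  tree : IBLTTree κ ℓ m

/-- The states of both parties. -/
structure World (κ ℓ m : ℕ) where
  client : Client κ ℓ m
  server : Server κ ℓ m

/-- The client's (encrypted) data: a block for each key in use. -/
abbrev Database (κ ℓ : ℕ) : Type := BitVec κ → Option (BitVec ℓ)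

/-- The set of keys in use. -/
def Database.keys {κ ℓ : ℕ} (D : Database κ ℓ) : Finset (BitVec κ) :=
  Finset.univ.filter fun k => (D k).isSome

/-- The pairs `(k, b)` of the database whose keys lie in `S`. -/
def Database.blocks {κ ℓ : ℕ} (D : Database κ ℓ) (S : Finset (BitVec κ)) :
    Finset (BitVec κ × BitVec ℓ) :=
  Finset.univ.filter fun x => x.1 ∈ S ∧ D x.1 = some x.2

/-- The blocks of the database with their tags. -/
def taggedStore {κ ℓ q m : ℕ} (pk : PublicKey κ q m) (sk : ℕ) (D : Database κ ℓ) : Store κ ℓ :=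
  fun k => (D k).map fun b => (b, tag pk sk k b)

/-- The state that the client ought to have when the database is `D`. -/
noncomputable def clientState {κ ℓ q m : ℕ} (pk : PublicKey κ q m) (sk : ℕ)
    (D : Database κ ℓ) : Client κ ℓ m :=
  ⟨D.keys, ibltOf pk.hash (taggedStore pk sk D) D.keys⟩

/-- `Setup`, once the keys are chosen. -/
noncomputable def setup {κ ℓ q m : ℕ} (pk : PublicKey κ q m) (sk : ℕ) (β : ℕ)
    (prio : BitVec κ → ℝ) (D : Database κ ℓ) : World κ ℓ m :=
  ⟨clientState pk sk D,
    ⟨taggedStore pk sk D, initTree pk.hash β prio (taggedStore pk sk D) D.keys⟩⟩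

/-- `Put`. -/
noncomputable def put {κ ℓ q m : ℕ} (pk : PublicKey κ q m) (sk : ℕ) (β : ℕ)
    (prio : BitVec κ → ℝ) (k : BitVec κ) (b : BitVec ℓ) (w : World κ ℓ m) : World κ ℓ m :=
  let t := tag pk sk k b
  let st := Function.update w.server.store k (some (b, t))
  ⟨⟨insert k w.client.keys, update pk.hash w.client.table k b t⟩,
    ⟨st, insertTree pk.hash β prio st k b t w.server.tree⟩⟩

/-- The server holds a block under the key `k` that passes the public test. -/
def Server.Holds {κ ℓ q m : ℕ} (pk : PublicKey κ q m) (srv : Server κ ℓ m) (k : BitVec κ) : Prop :=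
  ∃ b t, srv.store k = some (b, t) ∧ verify pk k b t

open Classical in
/-- The keys whose blocks are lost, or corrupted according to the public test. -/
noncomputable def Server.corrupted {κ ℓ q m : ℕ} (pk : PublicKey κ q m) (srv : Server κ ℓ m) :
    Finset (BitVec κ) :=
  srv.tree.keys.filter fun k => ¬ srv.Holds pk k

/-- The table that the server builds in an audit of the keys `K'`: all blocks except those of
`K'` and the lost or corrupted ones. -/
noncomputable def Server.proof {κ ℓ q m : ℕ} (pk : PublicKey κ q m) (srv : Server κ ℓ m)
    (K' : Finset (BitVec κ)) : IBLT κ ℓ m :=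
  constructIBLT pk.hash srv.store (K' ∪ srv.corrupted pk) srv.tree

/-- The key-block pairs in a list of triples. -/
def pairs {κ ℓ : ℕ} (L : List (Triple κ ℓ)) : Finset (BitVec κ × BitVec ℓ) :=
  (L.map fun x => (x.1, x.2.1)).toFinset

/-- `ClientAudit`; `none` is `reject`. -/
noncomputable def clientAudit {κ ℓ q m : ℕ} (pk : PublicKey κ q m) (sk : ℕ)
    (rule : PeelRule κ ℓ m) (K' : Finset (BitVec κ)) (w : World κ ℓ m) :
    Option (Finset (BitVec κ × BitVec ℓ)) :=
  (peel pk.hash (clientPure pk sk) rule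
    (combine w.client.table (w.server.proof pk K'))).map pairs

/-- The triples that the server recovers in an audit of its own. -/
noncomputable def Server.recover {κ ℓ q m : ℕ} (pk : PublicKey κ q m) (rule : PeelRule κ ℓ m)
    (K' : Finset (BitVec κ)) (srv : Server κ ℓ m) : Option (List (Triple κ ℓ)) :=
  peel pk.hash (serverPure pk) rule (combine srv.tree.root (srv.proof pk K'))

/-- `ServerAudit`; `none` is `failure`. -/
noncomputable def serverAudit {κ ℓ q m : ℕ} (pk : PublicKey κ q m) (rule : PeelRule κ ℓ m)
    (K' : Finset (BitVec κ)) (srv : Server κ ℓ m) : Option (Finset (BitVec κ × BitVec ℓ)) :=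
  (srv.recover pk rule K').map pairs

/-- `AccountabilityChallenge`: nothing but lost and corrupted blocks is left out of the server's
table; `none` is `reject`. -/
noncomputable def accountabilityChallenge {κ ℓ q m : ℕ} (pk : PublicKey κ q m) (sk : ℕ)
    (rule : PeelRule κ ℓ m) (w : World κ ℓ m) : Option (Finset (BitVec κ × BitVec ℓ)) :=
  (peel pk.hash (clientPure pk sk) rule (combine w.client.table (w.server.proof pk ∅))).map pairs

open Classical in
/-- The block and the tag that the server finds for `k` in `Get`: those in its storage if they
pass the test, and otherwise those that an audit of `k` recovers. -/
noncomputable def Server.find {κ ℓ q m : ℕ} (pk : PublicKey κ q m) (rule : PeelRule κ ℓ m)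
    (k : BitVec κ) (srv : Server κ ℓ m) : Option (BitVec ℓ × ℕ) :=
  if srv.Holds pk k then srv.store k
  else (srv.recover pk rule {k}).bind fun L => L.lookup k

/-- `Get`; `none` is `failure`. -/
noncomputable def get {κ ℓ q m : ℕ} (pk : PublicKey κ q m) (rule : PeelRule κ ℓ m)
    (k : BitVec κ) (srv : Server κ ℓ m) : Option (BitVec ℓ) :=
  (srv.find pk rule k).map Prod.fst

/-- `Delete`; `none` is `failure`.  The client recomputes the tag of the block she receives. -/
noncomputable def delete {κ ℓ q m : ℕ} (pk : PublicKey κ q m) (sk : ℕ) (β : ℕ)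
    (prio : BitVec κ → ℝ) (rule : PeelRule κ ℓ m) (k : BitVec κ) (w : World κ ℓ m) :
    Option (World κ ℓ m) :=
  (w.server.find pk rule k).map fun (b, t) =>
    let st := Function.update w.server.store k none
    ⟨⟨w.client.keys.erase k, update pk.hash w.client.table k b (tag pk sk k b)⟩,
      ⟨st, deleteTree pk.hash β prio st k b t w.server.tree⟩⟩

/-! ### Histories and corruption -/

/-- An operation that changes the data. -/
inductive Op (κ ℓ : ℕ) : Type
  | put (k : BitVec κ) (b : BitVec ℓ)
  | delete (k : BitVec κ)

/-- The intended effect of an operation on the client's data. -/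
def Op.onData {κ ℓ : ℕ} (D : Database κ ℓ) : Op κ ℓ → Database κ ℓ
  | .put k b => Function.update D k (some b)
  | .delete k => Function.update D k none

/-- `Put` takes a new key, `Delete` an existing one. -/
def Op.Valid {κ ℓ : ℕ} (D : Database κ ℓ) : Op κ ℓ → Prop
  | .put k _ => k ∉ D.keys
  | .delete k => k ∈ D.keys

/-- Every operation of the sequence is valid at its turn. -/
def ValidHistory {κ ℓ : ℕ} : Database κ ℓ → List (Op κ ℓ) → Prop
  | _, [] => True
  | D, o :: os => o.Valid D ∧ ValidHistory (o.onData D) os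

/-- The client's data after a sequence of operations. -/
def finalData {κ ℓ : ℕ} (D : Database κ ℓ) (os : List (Op κ ℓ)) : Database κ ℓ :=
  os.foldl Op.onData D

/-- Execution of an operation by the protocol.  A failing `Delete` leaves the states unchanged. -/
noncomputable def Op.exec {κ ℓ q m : ℕ} (pk : PublicKey κ q m) (sk : ℕ) (β : ℕ)
    (prio : BitVec κ → ℝ) (rule : PeelRule κ ℓ m) (w : World κ ℓ m) : Op κ ℓ → World κ ℓ m
  | .put k b => DAS.put pk sk β prio k b w
  | .delete k => (DAS.delete pk sk β prio rule k w).getD w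

/-- The states after `Setup` on `D` and a sequence of operations. -/
noncomputable def run {κ ℓ q m : ℕ} (pk : PublicKey κ q m) (sk : ℕ) (β : ℕ)
    (prio : BitVec κ → ℝ) (rule : PeelRule κ ℓ m) (D : Database κ ℓ) (os : List (Op κ ℓ)) :
    World κ ℓ m :=
  os.foldl (Op.exec pk sk β prio rule) (setup pk sk β prio D)

/-- `w'` arises from `w` by corruption of exactly the blocks with keys in `L`: under each of
these keys the server's storage is now empty or holds a block and a tag that fail the public
test. -/
structure Corrupts {κ ℓ q m : ℕ} (pk : PublicKey κ q m) (L : Finset (BitVec κ))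
    (w w' : World κ ℓ m) : Prop where
  client_eq : w'.client = w.client
  tree_eq : w'.server.tree = w.server.tree
  store_eq : ∀ k, k ∉ L → w'.server.store k = w.server.store k
  store_bad : ∀ k, k ∈ L → ¬ w'.server.Holds pk k

/-! ### Probability and correctness -/

/-- The random choices: `q` hash functions, fully random subject to the `q` cells of a key being
distinct, and the random oracle `h`. -/
abbrev Coins (κ q m N : ℕ) : Type := HashFamily κ q m × (BitVec κ → QR N)

/-- The public key with given random choices. -/
def Coins.key {κ q m N : ℕ} (e : ℕ) (g : QR N) (ω : Coins κ q m N) : PublicKey κ q m :=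
  ⟨N, e, ω.1, g, ω.2⟩

/-- The probability of `P` under the uniform distribution on a nonempty finite type. -/
noncomputable def uniformProb {Ω : Type} (P : Ω → Prop) : ℝ :=
  (Nat.card {ω : Ω // P ω} : ℝ) / (Nat.card Ω : ℝ)

/-- The probability, over the random choices, that `P` holds however `Peel` chooses among pure
cells and whatever is left in the storage under the corrupted keys `L`.  Here `P` is a property
of the public key, the rule for `Peel`, and the states of both parties after `Setup` on `D₀`,
the operations `os`, and the corruption of the blocks with keys in `L`. -/
noncomputable def successProb {κ ℓ m N : ℕ} (q e d β : ℕ) (g : QR N) (prio : BitVec κ → ℝ)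
    (D₀ : Database κ ℓ) (os : List (Op κ ℓ)) (L : Finset (BitVec κ))
    (P : PublicKey κ q m → PeelRule κ ℓ m → World κ ℓ m → Prop) : ℝ :=
  uniformProb fun ω : Coins κ q m N =>
    ∀ (rule : PeelRule κ ℓ m) (w : World κ ℓ m),
      Corrupts (ω.key e g) L (run (ω.key e g) d β prio rule D₀ os) w → P (ω.key e g) rule w

/-- Correctness up to error `ε` for given keys `(N, e, g)` and `d`, when at most `δ` blocks are
corrupted: after `Setup` and any valid sequence of `Put` and `Delete`, the procedures work as
they should, each with probability at least `1 - ε`. -/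
def IsCorrect (κ ℓ q m δ β N e d : ℕ) (g : QR N) (prio : BitVec κ → ℝ) (ε : ℝ) : Prop :=
  ∀ (D₀ : Database κ ℓ) (os : List (Op κ ℓ)), ValidHistory D₀ os →
  ∀ L : Finset (BitVec κ), L ⊆ (finalData D₀ os).keys → L.card ≤ δ →
    let D := finalData D₀ os
    let Pr := successProb (ℓ := ℓ) (m := m) q e d β g prio D₀ os L
    (∀ K' : Finset (BitVec κ), K' ⊆ D.keys → K'.card ≤ δ →
      1 - ε ≤ Pr (fun pk rule w => clientAudit pk d rule K' w = some (D.blocks (K' ∪ L))) ∧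
      1 - ε ≤ Pr (fun pk rule w => serverAudit pk rule K' w.server = some (D.blocks (K' ∪ L)))) ∧
    (∀ k ∈ D.keys,
      1 - ε ≤ Pr (fun pk rule w => get pk rule k w.server = D k) ∧
      1 - ε ≤ Pr (fun pk rule w => ∃ w', delete pk d β prio rule k w = some w' ∧
        w'.client = clientState pk d ((Op.delete k).onData D) ∧
        w'.server.tree.keys = D.keys.erase k ∧
        w'.server.store = Function.update w.server.store k none)) ∧
    1 - ε ≤ Pr (fun pk rule w => accountabilityChallenge pk d rule w = some (D.blocks L))

end DAS

/-!
Why the construction is correct.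

XOR makes cells into an elementary abelian `2`-group, so a table of stored triples is a sum over
its keys.  Along any valid history the client's table and every table in the server's tree are such
sums, and storage that is not corrupted passes the public test.  Hence, after the corruption of
`L`, each audit peels exactly the table of the honest triples with keys in `S = K' ∪ L`, and
`|S| ≤ 2δ` (`client_combine_eq`, `recover_eq`).

Peeling can fail for two reasons only (`BadCoins`, `peel_tableOf`).  Both are stated for all subsets
of `S` at once, which covers every order in which `Peel` chooses cells.

* Some nonempty `R ⊆ S` is a stopping set: no cell holds exactly one of its keys.  Then the `q |R|`
  incidences of `R` lie in at most `q |R| / 2` cells.  A union bound over `R` and over the set of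
  cells gives a geometric series with the factor `δ ^ (-(q - 2))` in front
  (`uniformProb_stoppingSet_le`, `stoppingSet_term_le`).
* At least two keys `A ⊆ S` share a cell, and the XOR of their triples passes the purity test.  What
  the client accepts, the server accepts too, so only the public test matters.  For fixed `A` the
  test passes with probability at most `2 / |QR N|`, of order `4 ^ (-τ)`: one value of the random
  oracle remains random after all others are fixed (`uniformProb_falsePositive_le`).  The keys of
  `A` all meet a given cell with probability at most `(q / m) ^ |A|`, and the sum of these bounds
  over all `A` is at most `(1 + q / m) ^ |S| ≤ e`.  Summing over the `m` cells gives the second term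
  (`uniformProb_exists_falsePositive_le`).
-/

namespace DAS

/-! ### Tables as sums of cells -/

instance Cell.instAdd {κ ℓ : ℕ} : Add (Cell κ ℓ) := ⟨Cell.xor⟩

instance Cell.instZero {κ ℓ : ℕ} : Zero (Cell κ ℓ) := ⟨⟨0, 0, 0⟩⟩

instance Cell.instNeg {κ ℓ : ℕ} : Neg (Cell κ ℓ) := ⟨id⟩

/-- Cells form an elementary abelian `2`-group under the fieldwise XOR. -/
instance Cell.instAddCommGroup {κ ℓ : ℕ} : AddCommGroup (Cell κ ℓ) where
  add_assoc a b c := by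
    change Cell.xor (Cell.xor a b) c = Cell.xor a (Cell.xor b c)
    simp [Cell.xor, BitVec.xor_assoc, Nat.xor_assoc]
  zero_add a := by
    change Cell.xor ⟨0, 0, 0⟩ a = a
    simp [Cell.xor]
  add_zero a := by
    change Cell.xor a ⟨0, 0, 0⟩ = a
    simp [Cell.xor]
  add_comm a b := by
    change Cell.xor a b = Cell.xor b a
    simp [Cell.xor, BitVec.xor_comm, Nat.xor_comm]
  neg_add_cancel a := by
    change Cell.xor a a = ⟨0, 0, 0⟩
    simp [Cell.xor]
  nsmul := nsmulRec
  zsmul := zsmulRec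

section Tables

variable {κ ℓ q m : ℕ}

theorem Cell.add_self (c : Cell κ ℓ) : c + c = 0 := neg_add_cancel c

theorem Cell.keySum_add (c c' : Cell κ ℓ) : (c + c').keySum = c.keySum ^^^ c'.keySum := rfl

theorem Cell.valueSum_add (c c' : Cell κ ℓ) : (c + c').valueSum = c.valueSum ^^^ c'.valueSum := rfl

theorem Cell.tagSum_add (c c' : Cell κ ℓ) : (c + c').tagSum = c.tagSum ^^^ c'.tagSum := rfl

theorem IBLT.add_self (T : IBLT κ ℓ m) : T + T = 0 := funext fun c => Cell.add_self (T c)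

theorem IBLT.empty_eq : IBLT.empty κ ℓ m = 0 := rfl

theorem combine_eq_add (T₁ T₂ : IBLT κ ℓ m) : combine T₁ T₂ = T₁ + T₂ := rfl

open Classical in
/-- The table that holds the single triple `(k, v, t)`. -/
noncomputable def singleTable (H : HashFamily κ q m) (k : BitVec κ) (v : BitVec ℓ) (t : ℕ) :
    IBLT κ ℓ m :=
  fun c => if ∃ i, H k i = c then ⟨k, v, t⟩ else 0

theorem update_eq_add (H : HashFamily κ q m) (T : IBLT κ ℓ m) (k : BitVec κ) (v : BitVec ℓ)
    (t : ℕ) : update H T k v t = T + singleTable H k v t := by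
  funext c
  change _ = T c + singleTable H k v t c
  unfold update singleTable
  split_ifs
  · rfl
  · rw [add_zero]

/-- The contribution of the key `k` to a table of stored triples. -/
noncomputable def storedTable (H : HashFamily κ q m) (st : Store κ ℓ) (k : BitVec κ) :
    IBLT κ ℓ m :=
  match st k with
  | some (b, t) => singleTable H k b t
  | none => 0

theorem storedTable_of_some {H : HashFamily κ q m} {st : Store κ ℓ} {k : BitVec κ}
    {b : BitVec ℓ} {t : ℕ} (h : st k = some (b, t)) :
    storedTable H st k = singleTable H k b t := by
  simp [storedTable, h]

theorem storedTable_congr {H : HashFamily κ q m} {st st' : Store κ ℓ} {k : BitVec κ}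
    (h : st k = st' k) : storedTable H st k = storedTable H st' k := by
  simp [storedTable, h]

theorem ibltOf_eq_sum (H : HashFamily κ q m) (st : Store κ ℓ) (S : Finset (BitVec κ)) :
    ibltOf H st S = ∑ k ∈ S, storedTable H st k := by
  have key : ∀ (l : List (BitVec κ)) (T : IBLT κ ℓ m),
      l.foldl (fun T k => match st k with
        | some (b, t) => update H T k b t
        | none => T) T = T + (l.map (storedTable H st)).sum := by
    intro l
    induction l with
    | nil => intro T; simp
    | cons k l ih =>
      intro T
      rw [List.foldl_cons, ih, List.map_cons, List.sum_cons, ← add_assoc]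
      congr 1
      unfold storedTable
      cases st k with
      | none => simp
      | some x => exact update_eq_add H T k x.1 x.2
  exact (key _ _).trans (by rw [IBLT.empty_eq, zero_add, Finset.sum_map_toList])

theorem ibltOf_congr {H : HashFamily κ q m} {st st' : Store κ ℓ} {S : Finset (BitVec κ)}
    (h : ∀ k ∈ S, st k = st' k) : ibltOf H st S = ibltOf H st' S := by
  rw [ibltOf_eq_sum, ibltOf_eq_sum]
  exact Finset.sum_congr rfl fun k hk => storedTable_congr (h k hk)

theorem ibltOf_union {H : HashFamily κ q m} {st : Store κ ℓ} {S S' : Finset (BitVec κ)}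
    (h : Disjoint S S') : ibltOf H st (S ∪ S') = ibltOf H st S + ibltOf H st S' := by
  simp only [ibltOf_eq_sum]
  exact Finset.sum_union h

theorem update_ibltOf_insert {H : HashFamily κ q m} {st : Store κ ℓ} {S : Finset (BitVec κ)}
    {k : BitVec κ} {b : BitVec ℓ} {t : ℕ} (hk : k ∉ S) (hst : st k = some (b, t)) :
    update H (ibltOf H st S) k b t = ibltOf H st (insert k S) := by
  rw [update_eq_add, ibltOf_eq_sum, ibltOf_eq_sum, Finset.sum_insert hk,
    storedTable_of_some hst, add_comm]

theorem update_ibltOf_erase {H : HashFamily κ q m} {st : Store κ ℓ} {S : Finset (BitVec κ)}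
    {k : BitVec κ} {b : BitVec ℓ} {t : ℕ} (hk : k ∈ S) (hst : st k = some (b, t)) :
    update H (ibltOf H st S) k b t = ibltOf H st (S.erase k) := by
  rw [update_eq_add, ibltOf_eq_sum, ibltOf_eq_sum, ← Finset.sum_erase_add _ _ hk,
    storedTable_of_some hst, add_assoc, IBLT.add_self, add_zero]

/-- Adding the tables of a set of keys and of a part of it leaves the table of the difference. -/
theorem ibltOf_add_ibltOf_sdiff {H : HashFamily κ q m} {st : Store κ ℓ}
    {S X : Finset (BitVec κ)} (hX : X ⊆ S) :
    ibltOf H st S + ibltOf H st (S \ X) = ibltOf H st X := by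
  have h : ibltOf H st S = ibltOf H st X + ibltOf H st (S \ X) := by
    rw [← ibltOf_union Finset.disjoint_sdiff, Finset.union_sdiff_of_subset hX]
  rw [h, add_assoc, IBLT.add_self, add_zero]

end Tables

/-! ### The IBLT tree -/

section Tree

variable {κ ℓ q m : ℕ}

/-- The search tree property. -/
def IBLTTree.Ordered : IBLTTree κ ℓ m → Prop
  | .leaf _ _ => True
  | .node _ l p r =>
    l.Ordered ∧ r.Ordered ∧ (∀ x ∈ l.keys, x < p) ∧ ∀ x ∈ r.keys, p < x

/-- Every node carries the table of the stored triples whose keys lie below it. -/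
def IBLTTree.Honest (H : HashFamily κ q m) (st : Store κ ℓ) : IBLTTree κ ℓ m → Prop
  | .leaf T S => T = ibltOf H st S
  | .node T l p r =>
    T = ibltOf H st (IBLTTree.node T l p r).keys ∧ l.Honest H st ∧ r.Honest H st

theorem IBLTTree.Honest.root_eq {H : HashFamily κ q m} {st : Store κ ℓ} {t : IBLTTree κ ℓ m}
    (h : t.Honest H st) : t.root = ibltOf H st t.keys := by
  cases t with
  | leaf T S => exact h
  | node T l p r => exact h.1

theorem IBLTTree.Honest.congr {H : HashFamily κ q m} {st st' : Store κ ℓ}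
    {t : IBLTTree κ ℓ m} (h : t.Honest H st) (hst : ∀ k ∈ t.keys, st k = st' k) :
    t.Honest H st' := by
  induction t with
  | leaf T S => exact h.trans (ibltOf_congr hst)
  | node T l p r ihl ihr =>
    refine ⟨h.1.trans (ibltOf_congr hst), ihl h.2.1 fun k hk => hst k ?_,
      ihr h.2.2 fun k hk => hst k ?_⟩ <;> simp [IBLTTree.keys, hk]

theorem bitVec_lt_trichotomy (x y : BitVec κ) : x < y ∨ x = y ∨ y < x := by
  rw [BitVec.lt_def, BitVec.lt_def, ← BitVec.toNat_inj]
  exact lt_trichotomy _ _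

theorem insert_union_filter {S : Finset (BitVec κ)} {p : BitVec κ} (hp : p ∈ S) :
    insert p (S.filter (· < p) ∪ S.filter (p < ·)) = S := by
  ext x
  simp only [Finset.mem_insert, Finset.mem_union, Finset.mem_filter]
  constructor
  · rintro (rfl | h | h)
    exacts [hp, h.1, h.1]
  · intro hx
    rcases bitVec_lt_trichotomy x p with h | h | h
    exacts [.inr (.inl ⟨hx, h⟩), .inl h, .inr (.inr ⟨hx, h⟩)]

theorem initTree_of_none {H : HashFamily κ q m} {β : ℕ} {prio : BitVec κ → ℝ} {st : Store κ ℓ}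
    {S : Finset (BitVec κ)} (h : pivot β prio S = none) :
    initTree H β prio st S = .leaf (ibltOf H st S) S := by
  rw [initTree]
  split
  · rfl
  · simp_all

theorem initTree_of_some {H : HashFamily κ q m} {β : ℕ} {prio : BitVec κ → ℝ} {st : Store κ ℓ}
    {S : Finset (BitVec κ)} {p : BitVec κ} (h : pivot β prio S = some p) :
    initTree H β prio st S =
      .node (combine (combine (initTree H β prio st (S.filter (· < p))).root
        (initTree H β prio st (S.filter (p < ·))).root) (ibltOf H st {p}))
        (initTree H β prio st (S.filter (· < p))) p (initTree H β prio st (S.filter (p < ·))) := by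
  rw [initTree]
  split
  · simp_all
  · rename_i p' h'
    obtain rfl : p = p' := by simpa [h] using h'
    rfl

theorem initTree_spec (H : HashFamily κ q m) (β : ℕ) (prio : BitVec κ → ℝ) (st : Store κ ℓ)
    (S : Finset (BitVec κ)) :
    (initTree H β prio st S).keys = S ∧ (initTree H β prio st S).Ordered ∧
      (initTree H β prio st S).Honest H st := by
  induction S using Finset.strongInduction with
  | H S ih =>
    cases h : pivot β prio S with
    | none =>
      rw [initTree_of_none h]
      exact ⟨rfl, trivial, rfl⟩
    | some p =>
      have hp := pivot_mem h
      obtain ⟨hlk, hlo, hlh⟩ := ih (S.filter (· < p))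
        (Finset.filter_ssubset.mpr ⟨p, hp, BitVec.lt_irrefl p⟩)
      obtain ⟨hrk, hro, hrh⟩ := ih (S.filter (p < ·))
        (Finset.filter_ssubset.mpr ⟨p, hp, BitVec.lt_irrefl p⟩)
      rw [initTree_of_some h]
      refine ⟨?_, ⟨hlo, hro, ?_, ?_⟩, ?_, hlh, hrh⟩
      · rw [IBLTTree.keys, hlk, hrk, insert_union_filter hp]
      · intro x hx
        rw [hlk] at hx
        exact (Finset.mem_filter.mp hx).2
      · intro x hx
        rw [hrk] at hx
        exact (Finset.mem_filter.mp hx).2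
      · rw [combine_eq_add, combine_eq_add, hlh.root_eq, hrh.root_eq, IBLTTree.keys, hlk, hrk,
          ← ibltOf_union, ← ibltOf_union, Finset.union_comm _ {p}, ← Finset.insert_eq]
        · simp
        · rw [Finset.disjoint_left]
          intro x hx hx'
          exact BitVec.lt_asymm (Finset.mem_filter.mp hx).2 (Finset.mem_filter.mp hx').2

theorem insertTree_spec {H : HashFamily κ q m} {β : ℕ} {prio : BitVec κ → ℝ} {st : Store κ ℓ}
    {k : BitVec κ} {b : BitVec ℓ} {t : ℕ} (hst : st k = some (b, t)) (T : IBLTTree κ ℓ m)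
    (ho : T.Ordered) (hh : T.Honest H st) (hk : k ∉ T.keys) :
    (insertTree H β prio st k b t T).keys = insert k T.keys ∧
      (insertTree H β prio st k b t T).Ordered ∧
      (insertTree H β prio st k b t T).Honest H st := by
  induction T with
  | leaf T S => exact initTree_spec H β prio st (insert k S)
  | node T l p r ihl ihr =>
    have hk' : k ≠ p ∧ k ∉ l.keys ∧ k ∉ r.keys := by
      simpa [IBLTTree.keys] using hk
    obtain ⟨hlo, hro, hl, hr⟩ := ho
    obtain ⟨hT, hlh, hrh⟩ := hh
    have hroot : update H T k b t = ibltOf H st (insert k (IBLTTree.node T l p r).keys) := by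
      rw [← update_ibltOf_insert hk hst, ← hT]
    rw [insertTree]
    split_ifs with h1 h2
    · obtain ⟨h3, h4, h5⟩ := ihl hlo hlh hk'.2.1
      have hkeys : insert p ((insertTree H β prio st k b t l).keys ∪ r.keys) =
          insert k (IBLTTree.node T l p r).keys := by
        rw [h3, IBLTTree.keys, Finset.insert_union, Finset.insert_comm]
      refine ⟨hkeys, ⟨h4, hro, ?_, hr⟩, hroot.trans (congrArg (ibltOf H st) hkeys.symm), h5, hrh⟩
      rw [h3]
      intro x hx
      rcases Finset.mem_insert.mp hx with rfl | hx
      exacts [h2, hl x hx]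
    · obtain ⟨h3, h4, h5⟩ := ihr hro hrh hk'.2.2
      have hkeys : insert p (l.keys ∪ (insertTree H β prio st k b t r).keys) =
          insert k (IBLTTree.node T l p r).keys := by
        rw [h3, IBLTTree.keys, Finset.union_insert, Finset.insert_comm]
      refine ⟨hkeys, ⟨hlo, h4, hl, ?_⟩, hroot.trans (congrArg (ibltOf H st) hkeys.symm), hlh, h5⟩
      rw [h3]
      intro x hx
      rcases Finset.mem_insert.mp hx with rfl | hx
      exacts [((bitVec_lt_trichotomy x p).resolve_left h2).resolve_left hk'.1, hr x hx]
    · exact initTree_spec H β prio st _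

/-- The keys below a node of a search tree after removal of `k`, when `k` is not the pivot and the
removal takes place in the left subtree if `k` is smaller than the pivot. -/
theorem keys_node_erase {T : IBLT κ ℓ m} {l r : IBLTTree κ ℓ m} {p k : BitVec κ}
    (ho : (IBLTTree.node T l p r).Ordered) (hkp : k ≠ p) :
    (k < p → insert p (l.keys.erase k ∪ r.keys) = (IBLTTree.node T l p r).keys.erase k ∧
      k ∉ r.keys) ∧
    (¬ k < p → insert p (l.keys ∪ r.keys.erase k) = (IBLTTree.node T l p r).keys.erase k ∧
      k ∉ l.keys) := by
  obtain ⟨-, -, hl, hr⟩ := ho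
  constructor
  · intro h
    have hkr : k ∉ r.keys := fun hk => BitVec.lt_asymm h (hr k hk)
    refine ⟨?_, hkr⟩
    rw [IBLTTree.keys, Finset.erase_insert_of_ne hkp.symm, Finset.erase_union_distrib,
      Finset.erase_eq_of_notMem hkr]
  · intro h
    have hkl : k ∉ l.keys := fun hk => h (hl k hk)
    refine ⟨?_, hkl⟩
    rw [IBLTTree.keys, Finset.erase_insert_of_ne hkp.symm, Finset.erase_union_distrib,
      Finset.erase_eq_of_notMem hkl]

theorem ne_of_pivot_erase {β : ℕ} {prio : BitVec κ → ℝ} {S : Finset (BitVec κ)} {k p : BitVec κ}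
    (h : pivot β prio (S.erase k) = some p) : k ≠ p :=
  (Finset.ne_of_mem_erase (pivot_mem h)).symm

theorem deleteTree_ordered {H : HashFamily κ q m} {β : ℕ} {prio : BitVec κ → ℝ}
    {st : Store κ ℓ} {k : BitVec κ} {b : BitVec ℓ} {t : ℕ} (T : IBLTTree κ ℓ m)
    (ho : T.Ordered) :
    (deleteTree H β prio st k b t T).keys = T.keys.erase k ∧
      (deleteTree H β prio st k b t T).Ordered := by
  induction T with
  | leaf T S =>
    have := initTree_spec H β prio st (S.erase k)
    exact ⟨this.1, this.2.1⟩
  | node T l p r ihl ihr =>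
    rw [deleteTree]
    split_ifs with h1 h2
    · have hkeys := ((keys_node_erase ho (ne_of_pivot_erase h1)).1 h2).1
      obtain ⟨hlo, hro, hl, hr⟩ := ho
      obtain ⟨h3, h4⟩ := ihl hlo
      refine ⟨by rw [IBLTTree.keys, h3, hkeys], h4, hro, fun x hx => hl x ?_, hr⟩
      rw [h3] at hx
      exact Finset.mem_of_mem_erase hx
    · have hkeys := ((keys_node_erase ho (ne_of_pivot_erase h1)).2 h2).1
      obtain ⟨hlo, hro, hl, hr⟩ := ho
      obtain ⟨h3, h4⟩ := ihr hro
      refine ⟨by rw [IBLTTree.keys, h3, hkeys], hlo, h4, hl, fun x hx => hr x ?_⟩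
      rw [h3] at hx
      exact Finset.mem_of_mem_erase hx
    · have := initTree_spec H β prio st ((IBLTTree.node T l p r).keys.erase k)
      exact ⟨this.1, this.2.1⟩

theorem deleteTree_honest {H : HashFamily κ q m} {β : ℕ} {prio : BitVec κ → ℝ}
    {st st' : Store κ ℓ} {k : BitVec κ} {b : BitVec ℓ} {t : ℕ} (hst : st k = some (b, t))
    (hst' : ∀ x, x ≠ k → st x = st' x) (T : IBLTTree κ ℓ m) (ho : T.Ordered)
    (hh : T.Honest H st) (hk : k ∈ T.keys) :
    (deleteTree H β prio st' k b t T).Honest H st' := by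
  induction T with
  | leaf T S => exact (initTree_spec H β prio st' (S.erase k)).2.2
  | node T l p r ihl ihr =>
    have hroot : update H T k b t = ibltOf H st' ((IBLTTree.node T l p r).keys.erase k) := by
      rw [← ibltOf_congr fun x hx => hst' x (Finset.ne_of_mem_erase hx),
        ← update_ibltOf_erase hk hst, ← hh.1]
    obtain ⟨hT, hlh, hrh⟩ := hh
    rw [deleteTree]
    split_ifs with h1 h2
    · have hkp := ne_of_pivot_erase h1
      obtain ⟨hkeys, hkr⟩ := (keys_node_erase ho hkp).1 h2
      obtain ⟨hlo, hro, hl, hr⟩ := ho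
      have hkl : k ∈ l.keys := by
        simpa [IBLTTree.keys, hkp, hkr] using hk
      refine ⟨hroot.trans ?_, ihl hlo hlh hkl,
        hrh.congr fun x hx => hst' x (ne_of_mem_of_not_mem hx hkr)⟩
      rw [← hkeys, ← (deleteTree_ordered l hlo).1]
      rfl
    · have hkp := ne_of_pivot_erase h1
      obtain ⟨hkeys, hkl⟩ := (keys_node_erase ho hkp).2 h2
      obtain ⟨hlo, hro, hl, hr⟩ := ho
      have hkr : k ∈ r.keys := by
        simpa [IBLTTree.keys, hkp, hkl] using hk
      refine ⟨hroot.trans ?_,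
        hlh.congr fun x hx => hst' x (ne_of_mem_of_not_mem hx hkl), ihr hro hrh hkr⟩
      rw [← hkeys, ← (deleteTree_ordered r hro).1]
      rfl
    · exact (initTree_spec H β prio st' _).2.2

/-- If the storage has changed only at keys in `X` since the tree was built, the table built
without the keys in `X` is the one that the original storage gives. -/
theorem constructIBLT_eq {H : HashFamily κ q m} {st st' : Store κ ℓ} {X : Finset (BitVec κ)}
    (hst : ∀ x, x ∉ X → st' x = st x) (T : IBLTTree κ ℓ m) (ho : T.Ordered)
    (hh : T.Honest H st) : constructIBLT H st' X T = ibltOf H st (T.keys \ X) := by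
  have hcongr : ∀ S : Finset (BitVec κ), ibltOf H st' (S \ X) = ibltOf H st (S \ X) := fun S =>
    ibltOf_congr fun x hx => hst x (Finset.mem_sdiff.mp hx).2
  induction T with
  | leaf T S =>
    rw [constructIBLT]
    split_ifs with h
    · rw [IBLTTree.keys, Finset.sdiff_eq_self_of_disjoint h]
      exact hh
    · exact hcongr S
  | node T l p r ihl ihr =>
    rw [constructIBLT]
    split_ifs with h
    · rw [Finset.sdiff_eq_self_of_disjoint h]
      exact hh.1
    · obtain ⟨hlo, hro, hl, hr⟩ := ho
      rw [ihl hlo hh.2.1, ihr hro hh.2.2, hcongr, combine_eq_add, combine_eq_add,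
        ← ibltOf_union, ← ibltOf_union, ← Finset.union_sdiff_distrib,
        ← Finset.union_sdiff_distrib, IBLTTree.keys, Finset.union_comm _ {p}, Finset.insert_eq]
      · refine Disjoint.mono (Finset.union_subset_union Finset.sdiff_subset Finset.sdiff_subset)
          Finset.sdiff_subset ?_
        rw [Finset.disjoint_singleton_right, Finset.mem_union]
        rintro (hp | hp)
        exacts [BitVec.lt_irrefl p (hl p hp), BitVec.lt_irrefl p (hr p hp)]
      · refine Disjoint.mono Finset.sdiff_subset Finset.sdiff_subset ?_
        rw [Finset.disjoint_left]
        intro x hx hx'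
        exact BitVec.lt_asymm (hl x hx) (hr x hx')

end Tree

/-! ### Tags -/

section Tags

variable {κ ℓ q m τ N e d : ℕ} {g : QR N}

theorem IsRSAKey.pos (hk : IsRSAKey τ N e d g) : 0 < N := by
  obtain ⟨p, p', hp, hp', -, rfl⟩ := hk.factors
  exact Nat.mul_pos hp.pos hp'.pos

theorem IsRSAKey.one_lt (hk : IsRSAKey τ N e d g) : 1 < N := by
  obtain ⟨p, p', hp, hp', -, rfl⟩ := hk.factors
  exact one_lt_mul'' hp.one_lt hp'.one_lt

theorem IsRSAKey.pow_pow (hk : IsRSAKey τ N e d g) (u : (ZMod N)ˣ) : (u ^ d) ^ e = u := by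
  rw [← pow_mul, pow_eq_pow_of_modEq hk.inverse (ZMod.pow_totient u), pow_one]

theorem IsRSAKey.pow_injective (hk : IsRSAKey τ N e d g) :
    Function.Injective fun u : (ZMod N)ˣ => u ^ e := by
  intro u v huv
  have h : (u ^ e) ^ d = (v ^ e) ^ d := congrArg (· ^ d) huv
  rwa [pow_right_comm, hk.pow_pow, pow_right_comm, hk.pow_pow] at h

/-- The residue `h(k) g^b` as a unit modulo `N`, for a modulus `N` that is not yet packed into a
public key. -/
def tagBase (g : QR N) (h : BitVec κ → QR N) (k : BitVec κ) (b : BitVec ℓ) : (ZMod N)ˣ :=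
  ((h k * g ^ b.toNat : QR N) : (ZMod N)ˣ)

theorem verify_iff {ω : Coins κ q m N} {k : BitVec κ} {b : BitVec ℓ} {t : ℕ} :
    verify (ω.key e g) k b t ↔ (t : ZMod N) ^ e = (tagBase g ω.2 k b : ZMod N) := Iff.rfl

theorem tag_eq (ω : Coins κ q m N) (k : BitVec κ) (b : BitVec ℓ) :
    tag (ω.key e g) d k b = ((tagBase g ω.2 k b ^ d : (ZMod N)ˣ) : ZMod N).val := rfl

theorem verify_tag (hk : IsRSAKey τ N e d g) (ω : Coins κ q m N) (k : BitVec κ)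
    (b : BitVec ℓ) : verify (ω.key e g) k b (tag (ω.key e g) d k b) := by
  have : NeZero N := ⟨hk.pos.ne'⟩
  rw [verify_iff, tag_eq, ZMod.natCast_zmod_val, ← Units.val_pow_eq_pow_val, hk.pow_pow]

theorem serverPure_of_clientPure (hk : IsRSAKey τ N e d g) {ω : Coins κ q m N} {c : Cell κ ℓ}
    (hc : clientPure (ω.key e g) d c) : serverPure (ω.key e g) c := by
  unfold clientPure at hc
  unfold serverPure
  rw [← hc]
  exact verify_tag hk ω _ _

/-- The empty cell fails the test because `0` is not a unit. -/
theorem not_serverPure_zero (hk : IsRSAKey τ N e d g) (ω : Coins κ q m N) :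
    ¬ serverPure (ω.key e g) (0 : Cell κ ℓ) := by
  have : Fact (1 < N) := ⟨hk.one_lt⟩
  intro h
  have h' : ((0 : ℕ) : ZMod N) ^ e = (tagBase g ω.2 (0 : BitVec κ) (0 : BitVec ℓ) : ZMod N) := h
  rw [Nat.cast_zero, zero_pow hk.prime_e.ne_zero] at h'
  exact Units.ne_zero _ h'.symm

end Tags

/-! ### The states of the parties after a history -/

section History

variable {κ ℓ q m τ N e d : ℕ} {g : QR N}

theorem Database.mem_keys {D : Database κ ℓ} {k : BitVec κ} :
    k ∈ D.keys ↔ ∃ b, D k = some b := by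
  simp [Database.keys, Option.isSome_iff_exists]

theorem Database.keys_put (D : Database κ ℓ) (k : BitVec κ) (b : BitVec ℓ) :
    Database.keys (Function.update D k (some b)) = insert k D.keys := by
  ext x
  rcases eq_or_ne x k with rfl | h <;> simp [Database.mem_keys, *]

theorem Database.keys_delete (D : Database κ ℓ) (k : BitVec κ) :
    Database.keys (Function.update D k none) = D.keys.erase k := by
  ext x
  rcases eq_or_ne x k with rfl | h <;> simp [Database.mem_keys, *]

theorem taggedStore_of_some {pk : PublicKey κ q m} {D : Database κ ℓ} {k : BitVec κ}
    {b : BitVec ℓ} (h : D k = some b) : taggedStore pk d D k = some (b, tag pk d k b) := by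
  simp [taggedStore, h]

theorem taggedStore_put (pk : PublicKey κ q m) (D : Database κ ℓ) (k : BitVec κ)
    (b : BitVec ℓ) : taggedStore pk d (Function.update D k (some b)) =
      Function.update (taggedStore pk d D) k (some (b, tag pk d k b)) := by
  funext x
  rcases eq_or_ne x k with rfl | h <;> simp [taggedStore, *]

theorem taggedStore_delete (pk : PublicKey κ q m) (D : Database κ ℓ) (k : BitVec κ) :
    taggedStore pk d (Function.update D k none) =
      Function.update (taggedStore pk d D) k none := by
  funext x
  rcases eq_or_ne x k with rfl | h <;> simp [taggedStore, *]

/-- Both parties are in the state that the database `D` calls for. -/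
structure World.Honest (pk : PublicKey κ q m) (d : ℕ) (D : Database κ ℓ) (w : World κ ℓ m) :
    Prop where
  client_eq : w.client = clientState pk d D
  store_eq : w.server.store = taggedStore pk d D
  keys_eq : w.server.tree.keys = D.keys
  ordered : w.server.tree.Ordered
  honest : w.server.tree.Honest pk.hash (taggedStore pk d D)

theorem setup_honest (pk : PublicKey κ q m) (d β : ℕ) (prio : BitVec κ → ℝ)
    (D : Database κ ℓ) : (setup pk d β prio D).Honest pk d D := by
  obtain ⟨h1, h2, h3⟩ := initTree_spec pk.hash β prio (taggedStore pk d D) D.keys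
  exact ⟨rfl, rfl, h1, h2, h3⟩

theorem put_honest {pk : PublicKey κ q m} {D : Database κ ℓ} {w : World κ ℓ m}
    (hw : w.Honest pk d D) (β : ℕ) (prio : BitVec κ → ℝ) {k : BitVec κ} (hk : k ∉ D.keys)
    (b : BitVec ℓ) :
    (put pk d β prio k b w).Honest pk d (Function.update D k (some b)) := by
  have hst : taggedStore pk d (Function.update D k (some b)) k = some (b, tag pk d k b) :=
    taggedStore_of_some (by simp)
  have hcongr : ∀ x ∈ D.keys,
      taggedStore pk d D x = taggedStore pk d (Function.update D k (some b)) x := by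
    intro x hx
    rw [taggedStore_put, Function.update_of_ne (ne_of_mem_of_not_mem hx hk)]
  have hstore : Function.update w.server.store k (some (b, tag pk d k b)) =
      taggedStore pk d (Function.update D k (some b)) := by
    rw [hw.store_eq, taggedStore_put]
  obtain ⟨h1, h2, h3⟩ := insertTree_spec (H := pk.hash) (β := β) (prio := prio) hst w.server.tree
    hw.ordered (hw.honest.congr (by rwa [hw.keys_eq])) (by rwa [hw.keys_eq])
  unfold put
  simp only [hstore]
  refine ⟨?_, rfl, ?_, h2, h3⟩
  · simp only [hw.client_eq, clientState, Database.keys_put]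
    rw [ibltOf_congr hcongr, update_ibltOf_insert hk hst]
  · rw [Database.keys_put, ← hw.keys_eq]
    exact h1

theorem find_of_holds {pk : PublicKey κ q m} {srv : Server κ ℓ m} {k : BitVec κ}
    (rule : PeelRule κ ℓ m) (h : srv.Holds pk k) : srv.find pk rule k = srv.store k := by
  rw [Server.find, if_pos h]

theorem clientState_delete {pk : PublicKey κ q m} {D : Database κ ℓ} {k : BitVec κ}
    {b : BitVec ℓ} (hb : D k = some b) :
    (⟨(clientState pk d D).keys.erase k,
      update pk.hash (clientState pk d D).table k b (tag pk d k b)⟩ : Client κ ℓ m) =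
      clientState pk d (Function.update D k none) := by
  simp only [clientState, Database.keys_delete]
  rw [update_ibltOf_erase (Database.mem_keys.mpr ⟨b, hb⟩) (taggedStore_of_some hb)]
  congr 1
  refine ibltOf_congr fun x hx => ?_
  rw [taggedStore_delete, Function.update_of_ne (Finset.ne_of_mem_erase hx)]

theorem delete_honest (hkey : IsRSAKey τ N e d g) {ω : Coins κ q m N} {D : Database κ ℓ}
    {w : World κ ℓ m} (hw : w.Honest (ω.key e g) d D) (β : ℕ) (prio : BitVec κ → ℝ)
    (rule : PeelRule κ ℓ m) {k : BitVec κ} (hk : k ∈ D.keys) :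
    ∃ w', delete (ω.key e g) d β prio rule k w = some w' ∧
      w'.Honest (ω.key e g) d (Function.update D k none) := by
  obtain ⟨b, hb⟩ := Database.mem_keys.mp hk
  have hst : taggedStore (ω.key e g) d D k = some (b, tag (ω.key e g) d k b) :=
    taggedStore_of_some hb
  have hfind : w.server.find (ω.key e g) rule k = some (b, tag (ω.key e g) d k b) := by
    rw [find_of_holds rule ⟨b, _, by rw [hw.store_eq, hst], verify_tag hkey ω k b⟩,
      hw.store_eq, hst]
  have hstore : Function.update w.server.store k none =
      taggedStore (ω.key e g) d (Function.update D k none) := by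
    rw [hw.store_eq, taggedStore_delete]
  have hmem : k ∈ w.server.tree.keys := by rwa [hw.keys_eq]
  have hother : ∀ x, x ≠ k → taggedStore (ω.key e g) d D x =
      taggedStore (ω.key e g) d (Function.update D k none) x := by
    intro x hx
    rw [taggedStore_delete, Function.update_of_ne hx]
  unfold delete
  rw [hfind]
  refine ⟨_, rfl, ?_⟩
  simp only [hstore]
  obtain ⟨h1, h2⟩ := deleteTree_ordered (H := (ω.key e g).hash) (β := β) (prio := prio)
    (st := taggedStore (ω.key e g) d (Function.update D k none)) (k := k) (b := b)
    (t := tag (ω.key e g) d k b) w.server.tree hw.ordered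
  refine ⟨?_, rfl, ?_, h2, deleteTree_honest hst hother _ hw.ordered hw.honest hmem⟩
  · simp only [hw.client_eq]
    exact clientState_delete hb
  · rw [Database.keys_delete, ← hw.keys_eq]
    exact h1

theorem run_honest (hkey : IsRSAKey τ N e d g) (ω : Coins κ q m N) (β : ℕ)
    (prio : BitVec κ → ℝ) (rule : PeelRule κ ℓ m) (D : Database κ ℓ) (os : List (Op κ ℓ))
    (hos : ValidHistory D os) :
    (run (ω.key e g) d β prio rule D os).Honest (ω.key e g) d (finalData D os) := by
  have key : ∀ (os : List (Op κ ℓ)) (D : Database κ ℓ) (w : World κ ℓ m),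
      ValidHistory D os → w.Honest (ω.key e g) d D →
      (os.foldl (Op.exec (ω.key e g) d β prio rule) w).Honest (ω.key e g) d
        (os.foldl Op.onData D) := by
    intro os
    induction os with
    | nil => exact fun D w _ hw => hw
    | cons o os ih =>
      intro D w hos hw
      refine ih _ _ hos.2 ?_
      cases o with
      | put k b => exact put_honest hw β prio hos.1 b
      | delete k =>
        obtain ⟨w', h1, h2⟩ := delete_honest hkey hw β prio rule hos.1
        change ((delete (ω.key e g) d β prio rule k w).getD w).Honest _ _ _
        rw [h1]
        exact h2
  exact key os D _ hos (setup_honest _ d β prio D)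

end History

/-! ### Peeling -/

section Peeling

variable {κ ℓ q m : ℕ}

open Classical in
/-- The keys of `R` that are hashed to the cell `c`. -/
noncomputable def keysAt (H : HashFamily κ q m) (R : Finset (BitVec κ)) (c : Fin m) :
    Finset (BitVec κ) :=
  R.filter fun k => ∃ i, H k i = c

theorem mem_keysAt {H : HashFamily κ q m} {R : Finset (BitVec κ)} {c : Fin m} {k : BitVec κ} :
    k ∈ keysAt H R c ↔ k ∈ R ∧ ∃ i, H k i = c := by
  classical
  exact Finset.mem_filter

theorem keysAt_subset (H : HashFamily κ q m) (R : Finset (BitVec κ)) (c : Fin m) :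
    keysAt H R c ⊆ R := fun _ hk => (mem_keysAt.mp hk).1

/-- A set of keys none of which is alone in a cell.  As a set of edges of the hypergraph on the
cells, it has minimum degree at least two on the cells that it meets. -/
def IsStoppingSet (H : HashFamily κ q m) (R : Finset (BitVec κ)) : Prop :=
  ∀ c, (keysAt H R c).card ≠ 1

variable (H : HashFamily κ q m) (b : BitVec κ → BitVec ℓ) (t : BitVec κ → ℕ)

/-- The table of the triples `(k, b k, t k)` with `k ∈ R`. -/
noncomputable def tableOf (R : Finset (BitVec κ)) : IBLT κ ℓ m :=
  ∑ k ∈ R, singleTable H k (b k) (t k)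

theorem tableOf_apply (R : Finset (BitVec κ)) (c : Fin m) :
    tableOf H b t R c = ∑ k ∈ keysAt H R c, (⟨k, b k, t k⟩ : Cell κ ℓ) := by
  classical
  rw [tableOf, Finset.sum_apply, keysAt, Finset.sum_filter]
  exact Finset.sum_congr rfl fun k _ => by simp only [singleTable]

theorem update_tableOf {R : Finset (BitVec κ)} {k : BitVec κ} (hk : k ∈ R) :
    update H (tableOf H b t R) k (b k) (t k) = tableOf H b t (R.erase k) := by
  rw [update_eq_add, tableOf, tableOf, ← Finset.sum_erase_add _ _ hk, add_assoc,
    IBLT.add_self, add_zero]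

variable {H b t} {isPure : Cell κ ℓ → Prop} {S : Finset (BitVec κ)}

theorem mem_pureCells {T : IBLT κ ℓ m} {c : Fin m} : c ∈ pureCells isPure T ↔ isPure (T c) := by
  simp [pureCells]

/-- In the absence of false positives of the purity test, a round of `Peel` removes one of the
remaining triples. -/
theorem peelStep_tableOf (rule : PeelRule κ ℓ m) (hzero : ¬ isPure 0)
    (hfalse : ∀ A ⊆ S, 2 ≤ A.card → ∀ c, (∀ k ∈ A, ∃ i, H k i = c) →
      ¬ isPure (∑ k ∈ A, (⟨k, b k, t k⟩ : Cell κ ℓ)))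
    {R : Finset (BitVec κ)} (hR : R ⊆ S) (out : List (Triple κ ℓ))
    (hne : (pureCells isPure (tableOf H b t R)).Nonempty) :
    ∃ k ∈ R, peelStep H isPure rule (tableOf H b t R, out) =
      (tableOf H b t (R.erase k), out ++ [(k, b k, t k)]) := by
  have hpick := mem_pureCells.mp (rule.pick_mem (tableOf H b t R) _ hne)
  set c := rule.pick (tableOf H b t R) (pureCells isPure (tableOf H b t R)) with hc
  rw [tableOf_apply] at hpick
  have hcard : (keysAt H R c).card = 1 := by
    by_contra h1
    rcases Nat.eq_zero_or_pos (keysAt H R c).card with h0 | hpos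
    · rw [Finset.card_eq_zero.mp h0, Finset.sum_empty] at hpick
      exact hzero hpick
    · exact hfalse _ ((keysAt_subset H R c).trans hR) (by omega) c
        (fun k hk => (mem_keysAt.mp hk).2) hpick
  obtain ⟨k, hk⟩ := Finset.card_eq_one.mp hcard
  have hkR : k ∈ R := keysAt_subset H R c (hk ▸ Finset.mem_singleton_self k)
  have hcell : tableOf H b t R c = ⟨k, b k, t k⟩ := by
    rw [tableOf_apply, hk, Finset.sum_singleton]
  refine ⟨k, hkR, ?_⟩
  simp only [peelStep, if_pos hne, ← hc, hcell, update_tableOf H b t hkR]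

theorem pureCells_tableOf_nonempty (hpure : ∀ k ∈ S, isPure ⟨k, b k, t k⟩)
    {R : Finset (BitVec κ)} (hR : R ⊆ S) (hstopping : ¬ IsStoppingSet H R) :
    pureCells isPure (tableOf H b t R) ≠ ∅ := by
  unfold IsStoppingSet at hstopping
  push Not at hstopping
  obtain ⟨c, hc⟩ := hstopping
  obtain ⟨k, hk⟩ := Finset.card_eq_one.mp hc
  have hkR : k ∈ R := keysAt_subset H R c (hk ▸ Finset.mem_singleton_self k)
  refine Finset.Nonempty.ne_empty ⟨c, mem_pureCells.mpr ?_⟩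
  rw [tableOf_apply, hk, Finset.sum_singleton]
  exact hpure k (hR hkR)

theorem peel_eq_some {rule : PeelRule κ ℓ m} {T : IBLT κ ℓ m} {n : ℕ} {out : List (Triple κ ℓ)}
    (hend : pureCells isPure ((peelStep H isPure rule)^[n] (T, [])).1 = ∅)
    (hmin : ∀ j < n, pureCells isPure ((peelStep H isPure rule)^[j] (T, [])).1 ≠ ∅)
    (hs : (peelStep H isPure rule)^[n] (T, []) = (IBLT.empty κ ℓ m, out)) :
    peel H isPure rule T = some out := by
  have hex : ∃ n, pureCells isPure ((peelStep H isPure rule)^[n] (T, [])).1 = ∅ := ⟨n, hend⟩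
  have hfind : ∀ inst : DecidablePred fun n =>
      pureCells isPure ((peelStep H isPure rule)^[n] (T, [])).1 = ∅,
      @Nat.find _ inst hex = n := fun inst => (Nat.find_eq_iff hex).mpr ⟨hend, hmin⟩
  rw [peel, dif_pos hex]
  simp only [hfind, hs, if_true]

/-- `Peel` lists a set of triples if the purity test has no false positives on it and the set has
no nonempty stopping set. -/
theorem peel_tableOf (rule : PeelRule κ ℓ m) (hzero : ¬ isPure 0)
    (hpure : ∀ k ∈ S, isPure ⟨k, b k, t k⟩)
    (hfalse : ∀ A ⊆ S, 2 ≤ A.card → ∀ c, (∀ k ∈ A, ∃ i, H k i = c) →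
      ¬ isPure (∑ k ∈ A, (⟨k, b k, t k⟩ : Cell κ ℓ)))
    (hstopping : ∀ R ⊆ S, R.Nonempty → ¬ IsStoppingSet H R) :
    ∃ out, peel H isPure rule (tableOf H b t S) = some out ∧
      ∀ x, x ∈ out ↔ ∃ k ∈ S, x = (k, b k, t k) := by
  set step := peelStep H isPure rule with hstep
  have inv : ∀ n, (∀ j < n, pureCells isPure (step^[j] (tableOf H b t S, [])).1 ≠ ∅) →
      ∃ R ⊆ S, ∃ out, step^[n] (tableOf H b t S, []) = (tableOf H b t R, out) ∧
        R.card + n ≤ S.card ∧ ∀ x, x ∈ out ↔ ∃ k ∈ S \ R, x = (k, b k, t k) := by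
    intro n
    induction n with
    | zero => exact fun _ => ⟨S, subset_rfl, [], rfl, le_rfl, by simp⟩
    | succ n ih =>
      intro hn
      obtain ⟨R, hR, out, hs, hcard, hout⟩ := ih fun j hj => hn j (hj.trans n.lt_succ_self)
      have hne := hn n n.lt_succ_self
      rw [hs] at hne
      obtain ⟨k, hk, hstep'⟩ := peelStep_tableOf rule hzero hfalse hR out
        (Finset.nonempty_iff_ne_empty.mpr hne)
      refine ⟨R.erase k, (Finset.erase_subset k R).trans hR, out ++ [(k, b k, t k)], ?_, ?_, ?_⟩
      · rw [Function.iterate_succ_apply', hs, hstep, hstep']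
      · have := Finset.card_erase_add_one hk
        omega
      · intro x
        simp only [List.mem_append, hout, List.mem_singleton, Finset.mem_sdiff, Finset.mem_erase]
        constructor
        · rintro (⟨j, ⟨hj, hj'⟩, rfl⟩ | rfl)
          exacts [⟨j, ⟨hj, fun h => hj' h.2⟩, rfl⟩, ⟨k, ⟨hR hk, fun h => h.1 rfl⟩, rfl⟩]
        · rintro ⟨j, ⟨hj, hj'⟩, rfl⟩
          rcases eq_or_ne j k with rfl | hjk
          exacts [.inr rfl, .inl ⟨j, ⟨hj, fun h => hj' ⟨hjk, h⟩⟩, rfl⟩]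
  have hex : ∃ n, pureCells isPure (step^[n] (tableOf H b t S, [])).1 = ∅ := by
    by_contra! hcon
    obtain ⟨R, -, out, -, hcard, -⟩ := inv (S.card + 1) fun j _ => (hcon j).ne_empty
    omega
  classical
  obtain ⟨R, hR, out, hs, -, hout⟩ := inv (Nat.find hex) fun j hj => Nat.find_min hex hj
  have hempty := Nat.find_spec hex
  rw [hs] at hempty
  obtain rfl : R = ∅ := by
    by_contra hne
    exact pureCells_tableOf_nonempty hpure hR (hstopping R hR (Finset.nonempty_iff_ne_empty.mpr hne))
      hempty
  refine ⟨out, ?_, by simpa using hout⟩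
  exact peel_eq_some (hs ▸ hempty) (fun j hj => Nat.find_min hex hj) hs

theorem lookup_eq_some {α β : Type*} [BEq α] [LawfulBEq α] {a : α} {v : β} {l : List (α × β)}
    (hmem : (a, v) ∈ l) (huniq : ∀ w, (a, w) ∈ l → w = v) : l.lookup a = some v := by
  induction l with
  | nil => simp at hmem
  | cons x l ih =>
    obtain ⟨a', w⟩ := x
    rw [List.lookup_cons]
    by_cases h : a = a'
    · subst h
      simp [huniq w (by simp)]
    · have h' : (a == a') = false := by simpa using h
      rw [h']
      refine ih ?_ fun w hw => huniq w (List.mem_cons_of_mem _ hw)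
      simpa [h] using hmem

end Peeling

/-! ### The audits as instances of peeling -/

section Audits

variable {κ ℓ q m τ N e d : ℕ} {g : QR N}

/-- The block of `k`, with a dummy value for keys that are not in use. -/
def Database.block (D : Database κ ℓ) (k : BitVec κ) : BitVec ℓ := (D k).getD 0

theorem Database.eq_some_block {D : Database κ ℓ} {k : BitVec κ} (hk : k ∈ D.keys) :
    D k = some (D.block k) := by
  obtain ⟨b, hb⟩ := Database.mem_keys.mp hk
  simp [Database.block, hb]

theorem ibltOf_taggedStore {pk : PublicKey κ q m} {D : Database κ ℓ} {S : Finset (BitVec κ)}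
    (hS : S ⊆ D.keys) : ibltOf pk.hash (taggedStore pk d D) S =
      tableOf pk.hash D.block (fun k => tag pk d k (D.block k)) S := by
  rw [ibltOf_eq_sum, tableOf]
  refine Finset.sum_congr rfl fun k hk => ?_
  rw [storedTable_of_some (taggedStore_of_some (Database.eq_some_block (hS hk)))]

/-- The random choices for which peeling of the triples with keys in `S` can go wrong: some cell
may at some time hold several of these triples whose XOR passes the public test, or the hash
functions leave a nonempty stopping set. -/
def BadCoins (e d : ℕ) (g : QR N) (D : Database κ ℓ) (S : Finset (BitVec κ))
    (ω : Coins κ q m N) : Prop :=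
  (∃ c, ∃ A ⊆ S, 2 ≤ A.card ∧ (∀ k ∈ A, ∃ i, ω.1 k i = c) ∧
    serverPure (ω.key e g)
      (∑ k ∈ A, (⟨k, D.block k, tag (ω.key e g) d k (D.block k)⟩ : Cell κ ℓ))) ∨
  ∃ R ⊆ S, R.Nonempty ∧ IsStoppingSet ω.1 R

theorem peel_of_not_badCoins (hkey : IsRSAKey τ N e d g) {ω : Coins κ q m N}
    {D : Database κ ℓ} {S : Finset (BitVec κ)} (hS : S ⊆ D.keys) (hω : ¬ BadCoins e d g D S ω)
    (rule : PeelRule κ ℓ m) {isPure : Cell κ ℓ → Prop}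
    (h₁ : ∀ c, clientPure (ω.key e g) d c → isPure c)
    (h₂ : ∀ c, isPure c → serverPure (ω.key e g) c) :
    ∃ out, peel ω.1 isPure rule (ibltOf ω.1 (taggedStore (ω.key e g) d D) S) = some out ∧
      ∀ x, x ∈ out ↔ ∃ k ∈ S, x = (k, D.block k, tag (ω.key e g) d k (D.block k)) := by
  rw [BadCoins, not_or] at hω
  have htable : ibltOf ω.1 (taggedStore (ω.key e g) d D) S = _ := ibltOf_taggedStore hS
  rw [htable]
  exact peel_tableOf rule (fun h => not_serverPure_zero hkey ω (h₂ _ h))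
    (fun k _ => h₁ _ rfl)
    (fun A hA hcard c hc h => hω.1 ⟨c, A, hA, hcard, hc, h₂ _ h⟩)
    (fun R hR hne h => hω.2 ⟨R, hR, hne, h⟩)

theorem pairs_eq_blocks {pk : PublicKey κ q m} {D : Database κ ℓ} {S : Finset (BitVec κ)}
    (hS : S ⊆ D.keys) {out : List (Triple κ ℓ)}
    (hout : ∀ x, x ∈ out ↔ ∃ k ∈ S, x = (k, D.block k, tag pk d k (D.block k))) :
    pairs out = D.blocks S := by
  ext ⟨k, b⟩
  simp only [pairs, List.mem_toFinset, List.mem_map, hout, Database.blocks, Finset.mem_filter,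
    Finset.mem_univ, true_and]
  constructor
  · rintro ⟨x, ⟨j, hj, rfl⟩, h⟩
    obtain ⟨rfl, rfl⟩ := Prod.mk.inj h
    exact ⟨hj, Database.eq_some_block (hS hj)⟩
  · rintro ⟨hk, hb⟩
    refine ⟨_, ⟨k, hk, rfl⟩, ?_⟩
    simp [Database.block, hb]

variable {ω : Coins κ q m N} {D : Database κ ℓ} {L : Finset (BitVec κ)} {w w' : World κ ℓ m}

theorem holds_iff_of_corrupts (hkey : IsRSAKey τ N e d g) (hw : w.Honest (ω.key e g) d D)
    (hc : Corrupts (ω.key e g) L w w') {k : BitVec κ} (hk : k ∈ D.keys) :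
    w'.server.Holds (ω.key e g) k ↔ k ∉ L := by
  refine ⟨fun h hL => hc.store_bad k hL h, fun hL => ?_⟩
  refine ⟨D.block k, _, ?_, verify_tag hkey ω k _⟩
  rw [hc.store_eq k hL, hw.store_eq, taggedStore_of_some (Database.eq_some_block hk)]

/-- The server leaves out exactly `K' ∪ L`.  The tables in its tree were built before the corruption,
and it reads its storage only at keys outside `L`. -/
theorem proof_eq (hkey : IsRSAKey τ N e d g) (hw : w.Honest (ω.key e g) d D)
    (hc : Corrupts (ω.key e g) L w w') (hL : L ⊆ D.keys) (K' : Finset (BitVec κ)) :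
    w'.server.proof (ω.key e g) K' =
      ibltOf ω.1 (taggedStore (ω.key e g) d D) (D.keys \ (K' ∪ L)) := by
  have hcor : w'.server.corrupted (ω.key e g) = L := by
    ext k
    simp only [Server.corrupted, Finset.mem_filter, hc.tree_eq, hw.keys_eq]
    constructor
    · rintro ⟨hk, h⟩
      by_contra hkL
      exact h ((holds_iff_of_corrupts hkey hw hc hk).mpr hkL)
    · exact fun hk => ⟨hL hk, hc.store_bad k hk⟩
  rw [Server.proof, hcor, hc.tree_eq, ← hw.keys_eq]
  refine constructIBLT_eq (fun x hx => ?_) _ hw.ordered hw.honest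
  rw [hc.store_eq x fun h => hx (Finset.mem_union_right _ h), hw.store_eq]

theorem client_combine_eq (hkey : IsRSAKey τ N e d g) (hw : w.Honest (ω.key e g) d D)
    (hc : Corrupts (ω.key e g) L w w') (hL : L ⊆ D.keys) {K' : Finset (BitVec κ)}
    (hK' : K' ⊆ D.keys) :
    combine w'.client.table (w'.server.proof (ω.key e g) K') =
      ibltOf ω.1 (taggedStore (ω.key e g) d D) (K' ∪ L) := by
  rw [proof_eq hkey hw hc hL, combine_eq_add, hc.client_eq, hw.client_eq]
  exact ibltOf_add_ibltOf_sdiff (Finset.union_subset hK' hL)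

theorem clientAudit_eq (hkey : IsRSAKey τ N e d g) (hw : w.Honest (ω.key e g) d D)
    (hc : Corrupts (ω.key e g) L w w') (hL : L ⊆ D.keys) {K' : Finset (BitVec κ)}
    (hK' : K' ⊆ D.keys) (hω : ¬ BadCoins e d g D (K' ∪ L) ω) (rule : PeelRule κ ℓ m) :
    clientAudit (ω.key e g) d rule K' w' = some (D.blocks (K' ∪ L)) := by
  have hS := Finset.union_subset hK' hL
  obtain ⟨out, h1, h2⟩ := peel_of_not_badCoins hkey hS hω rule
    (isPure := clientPure (ω.key e g) d) (fun _ h => h)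
    (fun _ h => serverPure_of_clientPure hkey h)
  rw [clientAudit, client_combine_eq hkey hw hc hL hK']
  change (peel ω.1 _ _ _).map pairs = _
  rw [h1, Option.map_some, pairs_eq_blocks hS h2]

theorem accountabilityChallenge_eq (hkey : IsRSAKey τ N e d g)
    (hw : w.Honest (ω.key e g) d D) (hc : Corrupts (ω.key e g) L w w') (hL : L ⊆ D.keys)
    (hω : ¬ BadCoins e d g D L ω) (rule : PeelRule κ ℓ m) :
    accountabilityChallenge (ω.key e g) d rule w' = some (D.blocks L) := by
  have h := clientAudit_eq hkey hw hc hL (Finset.empty_subset _)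
    (by rwa [Finset.empty_union]) rule
  rwa [Finset.empty_union] at h

theorem recover_eq (hkey : IsRSAKey τ N e d g) (hw : w.Honest (ω.key e g) d D)
    (hc : Corrupts (ω.key e g) L w w') (hL : L ⊆ D.keys) {K' : Finset (BitVec κ)}
    (hK' : K' ⊆ D.keys) (hω : ¬ BadCoins e d g D (K' ∪ L) ω) (rule : PeelRule κ ℓ m) :
    ∃ out, w'.server.recover (ω.key e g) rule K' = some out ∧ ∀ x, x ∈ out ↔
      ∃ k ∈ K' ∪ L, x = (k, D.block k, tag (ω.key e g) d k (D.block k)) := by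
  have hS := Finset.union_subset hK' hL
  obtain ⟨out, h1, h2⟩ := peel_of_not_badCoins hkey hS hω rule
    (isPure := serverPure (ω.key e g)) (fun _ h => serverPure_of_clientPure hkey h)
    (fun _ h => h)
  refine ⟨out, ?_, h2⟩
  rw [Server.recover, proof_eq hkey hw hc hL, combine_eq_add, hc.tree_eq, hw.honest.root_eq,
    hw.keys_eq]
  rw [← ibltOf_add_ibltOf_sdiff hS] at h1
  exact h1

theorem serverAudit_eq (hkey : IsRSAKey τ N e d g) (hw : w.Honest (ω.key e g) d D)
    (hc : Corrupts (ω.key e g) L w w') (hL : L ⊆ D.keys) {K' : Finset (BitVec κ)}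
    (hK' : K' ⊆ D.keys) (hω : ¬ BadCoins e d g D (K' ∪ L) ω) (rule : PeelRule κ ℓ m) :
    serverAudit (ω.key e g) rule K' w'.server = some (D.blocks (K' ∪ L)) := by
  obtain ⟨out, h1, h2⟩ := recover_eq hkey hw hc hL hK' hω rule
  rw [serverAudit, h1, Option.map_some, pairs_eq_blocks (Finset.union_subset hK' hL) h2]

/-- A corrupted block of `k ∈ L` is recovered by peeling the table of `{k} ∪ L = L`. -/
theorem find_eq (hkey : IsRSAKey τ N e d g) (hw : w.Honest (ω.key e g) d D)
    (hc : Corrupts (ω.key e g) L w w') (hL : L ⊆ D.keys) (hω : ¬ BadCoins e d g D L ω)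
    (rule : PeelRule κ ℓ m) {k : BitVec κ} (hk : k ∈ D.keys) :
    w'.server.find (ω.key e g) rule k =
      some (D.block k, tag (ω.key e g) d k (D.block k)) := by
  by_cases hkL : k ∈ L
  · have hunion : {k} ∪ L = L :=
      Finset.union_eq_right.mpr (Finset.singleton_subset_iff.mpr hkL)
    obtain ⟨out, h1, h2⟩ := recover_eq hkey hw hc hL (Finset.singleton_subset_iff.mpr hk)
      (by rwa [hunion]) rule
    rw [Server.find, if_neg (hc.store_bad k hkL), h1, Option.bind_some]
    refine lookup_eq_some ((h2 _).mpr ⟨k, by simp, rfl⟩) fun v hv => ?_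
    obtain ⟨j, -, hj⟩ := (h2 _).mp hv
    obtain ⟨rfl, rfl⟩ := Prod.mk.inj hj
    rfl
  · rw [find_of_holds rule ((holds_iff_of_corrupts hkey hw hc hk).mpr hkL),
      hc.store_eq k hkL, hw.store_eq, taggedStore_of_some (Database.eq_some_block hk)]

theorem get_eq (hkey : IsRSAKey τ N e d g) (hw : w.Honest (ω.key e g) d D)
    (hc : Corrupts (ω.key e g) L w w') (hL : L ⊆ D.keys) (hω : ¬ BadCoins e d g D L ω)
    (rule : PeelRule κ ℓ m) {k : BitVec κ} (hk : k ∈ D.keys) :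
    get (ω.key e g) rule k w'.server = D k := by
  rw [get, find_eq hkey hw hc hL hω rule hk, Option.map_some, Database.eq_some_block hk]

theorem delete_eq (hkey : IsRSAKey τ N e d g) (hw : w.Honest (ω.key e g) d D)
    (hc : Corrupts (ω.key e g) L w w') (hL : L ⊆ D.keys) (hω : ¬ BadCoins e d g D L ω)
    (β : ℕ) (prio : BitVec κ → ℝ) (rule : PeelRule κ ℓ m) {k : BitVec κ} (hk : k ∈ D.keys) :
    ∃ w'', delete (ω.key e g) d β prio rule k w' = some w'' ∧
      w''.client = clientState (ω.key e g) d ((Op.delete k).onData D) ∧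
      w''.server.tree.keys = D.keys.erase k ∧
      w''.server.store = Function.update w'.server.store k none := by
  rw [delete, find_eq hkey hw hc hL hω rule hk]
  refine ⟨_, rfl, ?_, ?_, rfl⟩
  · simp only [hc.client_eq, hw.client_eq]
    exact clientState_delete (Database.eq_some_block hk)
  · simp only [hc.tree_eq]
    rw [(deleteTree_ordered _ hw.ordered).1, hw.keys_eq]

end Audits

/-! ### Uniform probability -/

section Probability

variable {Ω Ω' : Type}

theorem uniformProb_eq [Fintype Ω] (P : Ω → Prop) [DecidablePred P] :
    uniformProb P = ((Finset.univ.filter P).card : ℝ) / Fintype.card Ω := by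
  rw [uniformProb, Nat.card_eq_fintype_card, Nat.card_eq_fintype_card, Fintype.card_subtype]

theorem uniformProb_nonneg (P : Ω → Prop) : 0 ≤ uniformProb P := by
  unfold uniformProb
  positivity

theorem uniformProb_mono [Finite Ω] {P Q : Ω → Prop} (h : ∀ ω, P ω → Q ω) :
    uniformProb P ≤ uniformProb Q := by
  classical
  have := Fintype.ofFinite Ω
  rw [uniformProb_eq, uniformProb_eq]
  gcongr
  exact h _

theorem one_sub_uniformProb_le [Finite Ω] [Nonempty Ω] {P B : Ω → Prop}
    (h : ∀ ω, ¬ B ω → P ω) : 1 - uniformProb B ≤ uniformProb P := by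
  classical
  have := Fintype.ofFinite Ω
  rw [uniformProb_eq, uniformProb_eq, sub_le_iff_le_add, ← add_div,
    one_le_div (by exact_mod_cast Fintype.card_pos)]
  norm_cast
  refine le_trans ?_ (Finset.card_union_le _ _)
  rw [← Finset.card_univ]
  refine Finset.card_le_card fun ω _ => ?_
  by_cases hω : B ω
  · simp [hω]
  · simp [h ω hω]

theorem uniformProb_or_le [Finite Ω] (P Q : Ω → Prop) :
    uniformProb (fun ω => P ω ∨ Q ω) ≤ uniformProb P + uniformProb Q := by
  classical
  have := Fintype.ofFinite Ω
  rw [uniformProb_eq, uniformProb_eq, uniformProb_eq, ← add_div, Finset.filter_or]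
  gcongr
  exact_mod_cast Finset.card_union_le _ _

theorem uniformProb_exists_le [Finite Ω] {ι : Type*} (s : Finset ι) (P : ι → Ω → Prop) :
    uniformProb (fun ω => ∃ i ∈ s, P i ω) ≤ ∑ i ∈ s, uniformProb (P i) := by
  classical
  induction s using Finset.induction with
  | empty => simp [uniformProb]
  | insert i s hi ih =>
    rw [Finset.sum_insert hi]
    refine le_trans ?_ ((uniformProb_or_le _ _).trans (add_le_add_right ih _))
    exact uniformProb_mono (by simp)

theorem uniformProb_prod [Finite Ω] [Finite Ω'] (P : Ω → Prop) (Q : Ω' → Prop) :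
    uniformProb (fun ω : Ω × Ω' => P ω.1 ∧ Q ω.2) = uniformProb P * uniformProb Q := by
  classical
  have := Fintype.ofFinite Ω
  have := Fintype.ofFinite Ω'
  rw [uniformProb_eq, uniformProb_eq, uniformProb_eq, div_mul_div_comm, Fintype.card_prod,
    ← Finset.univ_product_univ, Finset.filter_product, Finset.card_product]
  push_cast
  rfl

theorem uniformProb_fst_le [Finite Ω] [Finite Ω'] (P : Ω → Prop) :
    uniformProb (fun ω : Ω × Ω' => P ω.1) ≤ uniformProb P := by
  classical
  have h := uniformProb_prod P (fun _ : Ω' => True)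
  simp only [and_true] at h
  rw [h]
  refine mul_le_of_le_one_right (uniformProb_nonneg P) ?_
  have := Fintype.ofFinite Ω'
  rw [uniformProb_eq]
  exact div_le_one_of_le₀ (by simp) (Nat.cast_nonneg _)

/-- Independence of the values of a uniformly random function. -/
theorem uniformProb_forall_mem {ι α : Type} [Finite ι] [Finite α] [Nonempty α] (A : Finset ι)
    (P : α → Prop) :
    uniformProb (fun f : ι → α => ∀ i ∈ A, P (f i)) = uniformProb P ^ A.card := by
  classical
  have := Fintype.ofFinite ι
  have := Fintype.ofFinite α
  have hset : (Finset.univ.filter fun f : ι → α => ∀ i ∈ A, P (f i)) =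
      Fintype.piFinset fun i => if i ∈ A then Finset.univ.filter P else Finset.univ := by
    ext f
    simp only [Finset.mem_filter, Finset.mem_univ, true_and, Fintype.mem_piFinset]
    refine forall_congr' fun i => ?_
    by_cases hi : i ∈ A <;> simp [hi]
  rw [uniformProb_eq, uniformProb_eq, hset, Fintype.card_piFinset, Fintype.card_pi,
    div_pow, Nat.cast_prod, Nat.cast_prod, ← Finset.prod_div_distrib]
  have hne : (Fintype.card α : ℝ) ≠ 0 := by exact_mod_cast Fintype.card_ne_zero
  calc _ = ∏ i : ι, if i ∈ A then
        ((Finset.univ.filter P).card : ℝ) / Fintype.card α else 1 := by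
        refine Finset.prod_congr rfl fun i _ => ?_
        split_ifs
        · rfl
        · rw [Finset.card_univ, div_self hne]
    _ = _ := by
        rw [Finset.prod_ite_mem, Finset.univ_inter, Finset.prod_const, div_pow]

/-- If, whatever the other values of a random function are, at most `c` values at `i` make `P`
true, then `P` has probability at most `c / |α|`. -/
theorem uniformProb_le_of_update {ι α : Type} [Finite ι] [Finite α] [Nonempty α] [DecidableEq ι]
    (P : (ι → α) → Prop) (i : ι) (c : ℕ)
    (h : ∀ f, Nat.card {x // P (Function.update f i x)} ≤ c) :
    uniformProb P ≤ c / Nat.card α := by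
  classical
  have := Fintype.ofFinite ι
  have := Fintype.ofFinite α
  -- Exchanging the value at `i` for a fresh one is a bijection.
  let σ : (ι → α) × α ≃ (ι → α) × α :=
    { toFun := fun p => (Function.update p.1 i p.2, p.1 i)
      invFun := fun p => (Function.update p.1 i p.2, p.1 i)
      left_inv := fun p => by simp
      right_inv := fun p => by simp }
  have hcount : (Finset.univ.filter P).card * Fintype.card α ≤ Fintype.card (ι → α) * c := by
    calc (Finset.univ.filter P).card * Fintype.card α
        = ∑ p : (ι → α) × α, if P p.1 then 1 else 0 := by
          rw [Fintype.sum_prod_type]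
          rw [Finset.card_filter, mul_comm, Finset.mul_sum]
          refine Finset.sum_congr rfl fun f _ => ?_
          by_cases hf : P f <;> simp [hf]
      _ = ∑ p : (ι → α) × α, if P (Function.update p.1 i p.2) then 1 else 0 :=
          (Equiv.sum_comp σ fun p => if P p.1 then 1 else 0).symm
      _ = ∑ f : ι → α, Nat.card {x // P (Function.update f i x)} := by
          rw [Fintype.sum_prod_type]
          refine Finset.sum_congr rfl fun f _ => ?_
          rw [Nat.card_eq_fintype_card, Fintype.card_subtype, Finset.card_filter]
      _ ≤ ∑ _f : ι → α, c := Finset.sum_le_sum fun f _ => h f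
      _ = Fintype.card (ι → α) * c := by simp
  rw [uniformProb_eq, Nat.card_eq_fintype_card,
    div_le_div_iff₀ (by exact_mod_cast Fintype.card_pos) (by exact_mod_cast Fintype.card_pos),
    mul_comm (c : ℝ)]
  exact_mod_cast hcount

end Probability

/-! ### Random tuples of distinct cells -/

section Embeddings

variable {q m : ℕ}

theorem nonempty_embedding (h : q ≤ m) : Nonempty (Fin q ↪ Fin m) := ⟨Fin.castLEEmb h⟩

theorem uniformProb_apply_eq (hm : q ≤ m) (i : Fin q) (c : Fin m) :
    uniformProb (fun f : Fin q ↪ Fin m => f i = c) = 1 / m := by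
  classical
  have hsymm : ∀ c', (Finset.univ.filter fun f : Fin q ↪ Fin m => f i = c').card =
      (Finset.univ.filter fun f : Fin q ↪ Fin m => f i = c).card := by
    intro c'
    refine Finset.card_equiv
      (Equiv.embeddingCongr (Equiv.refl (Fin q)) (Equiv.swap c' c)) fun f => ?_
    simp only [Finset.mem_filter, Finset.mem_univ, true_and]
    change f i = c' ↔ Equiv.swap c' c (f i) = c
    rw [Equiv.swap_apply_eq_iff, Equiv.swap_apply_right]
  have hsum : Fintype.card (Fin q ↪ Fin m) =
      m * (Finset.univ.filter fun f : Fin q ↪ Fin m => f i = c).card := by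
    rw [← Finset.card_univ, Finset.card_eq_sum_card_fiberwise (f := fun f => f i)
      (t := Finset.univ) (fun _ _ => Finset.mem_coe.mpr (Finset.mem_univ _)),
      Finset.sum_congr rfl fun c' _ => hsymm c']
    simp
  have : Nonempty (Fin q ↪ Fin m) := nonempty_embedding hm
  have hpos : 0 < Fintype.card (Fin q ↪ Fin m) := Fintype.card_pos
  rw [uniformProb_eq, hsum]
  rw [hsum] at hpos
  have h1 : (m : ℝ) ≠ 0 := by exact_mod_cast (pos_of_mul_pos_left hpos (Nat.zero_le _)).ne'
  have h2 := (Nat.pos_of_mul_pos_left hpos).ne'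
  push_cast
  field_simp

theorem uniformProb_exists_apply_eq_le (hm : q ≤ m) (c : Fin m) :
    uniformProb (fun f : Fin q ↪ Fin m => ∃ i, f i = c) ≤ q / m := by
  refine (uniformProb_mono fun f ⟨i, hi⟩ => ⟨i, Finset.mem_univ i, hi⟩).trans
    ((uniformProb_exists_le Finset.univ fun i (f : Fin q ↪ Fin m) => f i = c).trans_eq ?_)
  simp [uniformProb_apply_eq hm, div_eq_mul_inv]

theorem descFactorial_mul_pow_le {s m : ℕ} (h : s ≤ m) (q : ℕ) :
    s.descFactorial q * m ^ q ≤ m.descFactorial q * s ^ q := by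
  induction q with
  | zero => simp
  | succ q ih =>
    have h' : (s - q) * m ≤ (m - q) * s := by
      rw [Nat.sub_mul, Nat.sub_mul, mul_comm m s]
      exact Nat.sub_le_sub_left (Nat.mul_le_mul_left q h) _
    rw [Nat.descFactorial_succ, Nat.descFactorial_succ, pow_succ, pow_succ]
    calc (s - q) * s.descFactorial q * (m ^ q * m)
        = ((s - q) * m) * (s.descFactorial q * m ^ q) := by ring
      _ ≤ ((m - q) * s) * (m.descFactorial q * s ^ q) := Nat.mul_le_mul h' ih
      _ = _ := by ring

theorem uniformProb_forall_apply_mem_le (hq : 0 < q) (hm : q ≤ m) (F : Finset (Fin m)) :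
    uniformProb (fun f : Fin q ↪ Fin m => ∀ i, f i ∈ F) ≤ ((F.card : ℝ) / m) ^ q := by
  classical
  have hle : Nat.card {f : Fin q ↪ Fin m // ∀ i, f i ∈ F} ≤ F.card.descFactorial q := by
    have hcard : Nat.card (Fin q ↪ F) = F.card.descFactorial q := by
      rw [Nat.card_eq_fintype_card, Fintype.card_embedding_eq]
      simp
    rw [← hcard]
    refine Nat.card_le_card_of_injective
      (fun f => (⟨fun i => ⟨f.1 i, f.2 i⟩, fun i j hij => f.1.injective (by simpa using hij)⟩ :
        Fin q ↪ F)) fun f f' hff' => ?_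
    ext i
    exact congrArg (fun f : Fin q ↪ F => ((f i : Fin m) : ℕ)) hff'
  have hm0 : 0 < m := hq.trans_le hm
  rw [uniformProb, Nat.card_eq_fintype_card (α := Fin q ↪ Fin m), Fintype.card_embedding_eq,
    Fintype.card_fin, Fintype.card_fin, div_pow,
    div_le_div_iff₀ (by exact_mod_cast Nat.descFactorial_pos.mpr hm) (by positivity)]
  norm_cast
  refine (Nat.mul_le_mul_right _ hle).trans ?_
  rw [mul_comm (F.card ^ q)]
  exact descFactorial_mul_pow_le (by simpa using Finset.card_le_univ F) q

end Embeddings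

/-! ### Stopping sets of a random hypergraph -/

section StoppingSets

variable {κ q m : ℕ}

/-- The cells met by a stopping set are at most half as many as its incidences. -/
theorem IsStoppingSet.exists_cover {H : HashFamily κ q m} {R : Finset (BitVec κ)}
    (h : IsStoppingSet H R) (hm : q * R.card / 2 ≤ m) :
    ∃ F : Finset (Fin m), F.card = q * R.card / 2 ∧ ∀ k ∈ R, ∀ i, H k i ∈ F := by
  classical
  set F₀ : Finset (Fin m) := Finset.univ.filter fun c => (keysAt H R c).Nonempty
  have hsum : ∑ c : Fin m, (keysAt H R c).card = q * R.card := by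
    have h1 := Finset.sum_card_bipartiteAbove_eq_sum_card_bipartiteBelow
      (s := (Finset.univ : Finset (Fin m))) (t := R) (fun c k => ∃ i, H k i = c)
    have h2 : ∀ k ∈ R, (Finset.bipartiteBelow (fun c k => ∃ i, H k i = c)
        (Finset.univ : Finset (Fin m)) k).card = q := by
      intro k _
      have : Finset.bipartiteBelow (fun c k => ∃ i, H k i = c)
          (Finset.univ : Finset (Fin m)) k = Finset.univ.map (H k) := by
        ext c
        simp [Finset.bipartiteBelow]
      rw [this, Finset.card_map, Finset.card_univ, Fintype.card_fin]
    rw [Finset.sum_congr rfl h2, Finset.sum_const, smul_eq_mul, mul_comm] at h1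
    rw [← h1]
    refine Finset.sum_congr rfl fun c _ => congrArg Finset.card ?_
    ext k
    simp [Finset.bipartiteAbove, mem_keysAt]
  have hF₀ : F₀.card ≤ q * R.card / 2 := by
    rw [Nat.le_div_iff_mul_le two_pos, ← hsum, ← smul_eq_mul, ← Finset.sum_const]
    refine (Finset.sum_le_sum fun c hc => ?_).trans
      (Finset.sum_le_sum_of_subset (Finset.subset_univ F₀))
    have h0 := Finset.card_pos.mpr (Finset.mem_filter.mp hc).2
    have h1 := h c
    omega
  obtain ⟨F, hF, hcard⟩ := Finset.exists_superset_card_eq hF₀ (by simpa using hm)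
  refine ⟨F, hcard, fun k hk i => hF ?_⟩
  exact Finset.mem_filter.mpr ⟨Finset.mem_univ _, k, mem_keysAt.mpr ⟨hk, i, rfl⟩⟩

theorem IsStoppingSet.two_le_card (hq : 0 < q) {H : HashFamily κ q m} {R : Finset (BitVec κ)}
    (h : IsStoppingSet H R) (hne : R.Nonempty) : 2 ≤ R.card := by
  have h0 := hne.card_pos
  by_contra hlt
  obtain ⟨k, rfl⟩ := Finset.card_eq_one.mp (by omega : R.card = 1)
  refine h (H k ⟨0, hq⟩) ?_
  rw [Finset.card_eq_one]
  refine ⟨k, Finset.eq_singleton_iff_unique_mem.mpr ⟨mem_keysAt.mpr ⟨by simp, _, rfl⟩, ?_⟩⟩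
  exact fun j hj => Finset.mem_singleton.mp (mem_keysAt.mp hj).1

/-- The first-moment bound: sum over the stopping set `R` and over a set of `⌊q |R| / 2⌋` cells
that contains all cells of `R`. -/
theorem uniformProb_stoppingSet_le (hq : 0 < q) (hm : q ≤ m) (S : Finset (BitVec κ))
    (hS : q * S.card / 2 ≤ m) :
    uniformProb (fun H : HashFamily κ q m => ∃ R ⊆ S, R.Nonempty ∧ IsStoppingSet H R) ≤
      ∑ r ∈ Finset.range (S.card + 1), if 2 ≤ r then
        (S.card.choose r : ℝ) * ((m.choose (q * r / 2) : ℝ) *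
          (((q * r / 2 : ℕ) : ℝ) / m) ^ (q * r)) else 0 := by
  classical
  have : Nonempty (Fin q ↪ Fin m) := nonempty_embedding hm
  have h1 : ∀ H : HashFamily κ q m, (∃ R ⊆ S, R.Nonempty ∧ IsStoppingSet H R) →
      ∃ R ∈ S.powerset.filter fun R => 2 ≤ R.card,
        ∃ F ∈ (Finset.univ : Finset (Fin m)).powersetCard (q * R.card / 2),
          ∀ k ∈ R, ∀ i, H k i ∈ F := by
    rintro H ⟨R, hR, hne, hstopping⟩
    obtain ⟨F, hF, hcov⟩ := hstopping.exists_cover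
      ((Nat.div_le_div_right (Nat.mul_le_mul_left q (Finset.card_le_card hR))).trans hS)
    exact ⟨R, Finset.mem_filter.mpr ⟨Finset.mem_powerset.mpr hR, hstopping.two_le_card hq hne⟩, F,
      Finset.mem_powersetCard.mpr ⟨Finset.subset_univ F, hF⟩, hcov⟩
  refine (uniformProb_mono h1).trans ((uniformProb_exists_le _ _).trans ?_)
  have h2 : ∀ R : Finset (BitVec κ),
      uniformProb (fun H : HashFamily κ q m =>
        ∃ F ∈ (Finset.univ : Finset (Fin m)).powersetCard (q * R.card / 2),
          ∀ k ∈ R, ∀ i, H k i ∈ F) ≤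
      (m.choose (q * R.card / 2) : ℝ) *
        (((q * R.card / 2 : ℕ) : ℝ) / m) ^ (q * R.card) := by
    intro R
    refine (uniformProb_exists_le _ _).trans ?_
    rw [← Fintype.card_fin m, ← Finset.card_univ, ← Finset.card_powersetCard, ← nsmul_eq_mul,
      Finset.card_univ, Fintype.card_fin]
    refine Finset.sum_le_card_nsmul _ _ _ fun F hF => ?_
    rw [uniformProb_forall_mem R fun f : Fin q ↪ Fin m => ∀ i, f i ∈ F, pow_mul,
      ← (Finset.mem_powersetCard.mp hF).2]
    gcongr
    · exact uniformProb_nonneg _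
    · exact uniformProb_forall_apply_mem_le hq hm F
  refine (Finset.sum_le_sum fun R _ => h2 R).trans_eq ?_
  rw [Finset.sum_filter]
  rw [Finset.sum_powerset_apply_card (fun r => if 2 ≤ r then
    (m.choose (q * r / 2) : ℝ) * (((q * r / 2 : ℕ) : ℝ) / m) ^ (q * r) else 0)]
  refine Finset.sum_congr rfl fun r _ => ?_
  rw [nsmul_eq_mul, mul_ite, mul_zero]

/-- `C(m, s) (s / m)^s ≤ e^s`. -/
theorem choose_mul_div_pow_le (m s : ℕ) :
    (m.choose s : ℝ) * ((s : ℝ) / m) ^ s ≤ Real.exp s := by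
  rcases Nat.eq_zero_or_pos m with rfl | hm
  · rcases Nat.eq_zero_or_pos s with rfl | hs
    · simp
    · rw [Nat.choose_eq_zero_of_lt hs]
      simpa using (Real.exp_pos _).le
  have hm' : (0 : ℝ) < m := by exact_mod_cast hm
  calc (m.choose s : ℝ) * ((s : ℝ) / m) ^ s
      ≤ (m : ℝ) ^ s / (s.factorial : ℝ) * ((s : ℝ) / m) ^ s := by
        gcongr
        exact Nat.choose_le_pow_div s m
    _ = (s : ℝ) ^ s / s.factorial := by
        rw [div_pow]
        field_simp
    _ ≤ Real.exp s := Real.pow_div_factorial_le_exp _ (Nat.cast_nonneg s) s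

/-- One term of the first-moment bound.  With `s = ⌊q r / 2⌋` and `u = q r / (2 m)` it is at most
`e^(q r) e^r (n / r)^r u^(q r / 2)`, and of the factor `u^(q r / 2)`, a power `u^r` compensates
`(n / r)^r` and a power `u^(q - 2)` gives the decay in `δ`. -/
theorem stoppingSet_term_le {q a δ n m r : ℕ} (hq : 3 ≤ q) (hδ : 1 ≤ δ) (hr : 2 ≤ r)
    (hrn : r ≤ n) (hn : n ≤ 2 * δ) (ha : 2 * (q : ℝ) * Real.exp (q + 2) ≤ a)
    (hm : a * δ ≤ m) :
    (n.choose r : ℝ) * ((m.choose (q * r / 2) : ℝ) *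
      (((q * r / 2 : ℕ) : ℝ) / m) ^ (q * r)) ≤
    ((q - 2).factorial : ℝ) / (δ : ℝ) ^ (q - 2) * (1 / 2) ^ r := by
  have hq0 : (0 : ℝ) < q := by exact_mod_cast (by omega : 0 < q)
  have hr0 : (0 : ℝ) < r := by exact_mod_cast (by omega : 0 < r)
  have hδ0 : (0 : ℝ) < δ := by exact_mod_cast hδ
  have hn0 : (0 : ℝ) < n := by exact_mod_cast (by omega : 0 < n)
  have hmR : 2 * (q : ℝ) * Real.exp (q + 2) * δ ≤ m := by
    calc _ ≤ (a : ℝ) * δ := by gcongr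
      _ ≤ m := by exact_mod_cast hm
  have hqm : 2 * (q : ℝ) * δ ≤ m := by
    refine le_trans ?_ hmR
    have h1 : 1 ≤ Real.exp (q + 2 : ℝ) := Real.one_le_exp (by positivity)
    have := mul_le_mul_of_nonneg_left h1 (by positivity : 0 ≤ 2 * (q : ℝ) * δ)
    linarith
  have hm0 : (0 : ℝ) < m := lt_of_lt_of_le (by positivity) hqm
  have hrδ : (r : ℝ) ≤ 2 * δ := by exact_mod_cast hrn.trans hn
  have hnδ : (n : ℝ) ≤ 2 * δ := by exact_mod_cast hn
  set s := q * r / 2 with hs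
  set u : ℝ := q * r / (2 * m) with hu
  have hu0 : 0 ≤ u := by positivity
  have hu1 : u ≤ 1 := by
    rw [hu, div_le_one (by positivity)]
    have := mul_le_mul_of_nonneg_left hrδ hq0.le
    linarith
  have hsu : (s : ℝ) / m ≤ u := by
    have h2s : (2 : ℝ) * s ≤ q * r := by exact_mod_cast Nat.mul_div_le (q * r) 2
    rw [hu, div_le_div_iff₀ hm0 (by positivity)]
    have := mul_le_mul_of_nonneg_right h2s hm0.le
    linarith
  have hsle : s ≤ q * r := Nat.div_le_self _ _
  -- The power `u^(q r - s)` with `q r - s ≥ q r / 2`, by way of the square root of `u`.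
  have hpow : ((s : ℝ) / m) ^ (q * r - s) ≤ u ^ r * u ^ (q - 2) := by
    set y := Real.sqrt u with hy
    have hy0 : 0 ≤ y := Real.sqrt_nonneg u
    have hy1 : y ≤ 1 := Real.sqrt_le_one.mpr hu1
    have hyu : y ^ 2 = u := Real.sq_sqrt hu0
    calc ((s : ℝ) / m) ^ (q * r - s) ≤ u ^ (q * r - s) := by gcongr
      _ = y ^ (2 * (q * r - s)) := by rw [pow_mul, hyu]
      _ ≤ y ^ (2 * r + 2 * (q - 2)) := by
          refine pow_le_pow_of_le_one hy0 hy1 ?_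
          obtain ⟨q', rfl⟩ := Nat.exists_eq_add_of_le (by omega : 2 ≤ q)
          obtain ⟨r', rfl⟩ := Nat.exists_eq_add_of_le hr
          have h1 : (2 + q') * (2 + r') = 4 + 2 * q' + 2 * r' + q' * r' := by ring
          rw [h1] at hs ⊢
          simp only [Nat.add_sub_cancel_left]
          omega
      _ = u ^ r * u ^ (q - 2) := by rw [pow_add, pow_mul, pow_mul, hyu]
  have hcells : (m.choose s : ℝ) * ((s : ℝ) / m) ^ (q * r) ≤
      Real.exp (q * r) * (u ^ r * u ^ (q - 2)) := by
    calc (m.choose s : ℝ) * ((s : ℝ) / m) ^ (q * r)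
        = ((m.choose s : ℝ) * ((s : ℝ) / m) ^ s) * ((s : ℝ) / m) ^ (q * r - s) := by
          rw [mul_assoc, ← pow_add, Nat.add_sub_cancel' hsle]
      _ ≤ Real.exp s * (u ^ r * u ^ (q - 2)) := by
          gcongr
          exact choose_mul_div_pow_le m s
      _ ≤ _ := by
          gcongr
          exact_mod_cast hsle
  have hkeys : (n.choose r : ℝ) ≤ ((n : ℝ) / r) ^ r * Real.exp r := by
    have h := choose_mul_div_pow_le n r
    rw [← le_div_iff₀ (by positivity)] at h
    refine h.trans_eq ?_
    rw [div_eq_mul_inv, ← inv_pow, inv_div, mul_comm]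
  have hr2 : (r : ℝ) ^ (q - 2) ≤ (q - 2).factorial * Real.exp r := by
    have h := Real.pow_div_factorial_le_exp (r : ℝ) hr0.le (q - 2)
    rw [div_le_iff₀ (by positivity)] at h
    linarith
  have huδ : u ^ (q - 2) ≤ (q - 2).factorial * Real.exp r / (δ : ℝ) ^ (q - 2) := by
    calc u ^ (q - 2) ≤ ((r : ℝ) / δ) ^ (q - 2) := by
          gcongr
          rw [hu, div_le_div_iff₀ (by positivity) hδ0]
          have := mul_le_mul_of_nonneg_right hqm hr0.le
          have h3 : 0 ≤ (q : ℝ) * r * δ := by positivity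
          have h4 : 0 ≤ (m : ℝ) * r := by positivity
          linarith
      _ = (r : ℝ) ^ (q - 2) / (δ : ℝ) ^ (q - 2) := div_pow _ _ _
      _ ≤ _ := by gcongr
  have hbase : Real.exp (q + 2) * ((n : ℝ) / r * u) ≤ 1 / 2 := by
    have h1 : (n : ℝ) / r * u = q * n / (2 * m) := by
      rw [hu]
      field_simp
    rw [h1, ← mul_div_assoc, div_le_div_iff₀ (by positivity) two_pos]
    have h2 := mul_le_mul_of_nonneg_left hnδ
      (by positivity : 0 ≤ Real.exp (q + 2 : ℝ) * q)
    linarith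
  calc (n.choose r : ℝ) * ((m.choose s : ℝ) * ((s : ℝ) / m) ^ (q * r))
      ≤ (((n : ℝ) / r) ^ r * Real.exp r) * (Real.exp (q * r) * (u ^ r *
          ((q - 2).factorial * Real.exp r / (δ : ℝ) ^ (q - 2)))) := by
        refine mul_le_mul hkeys (hcells.trans ?_) (by positivity) (by positivity)
        gcongr
    _ = ((q - 2).factorial : ℝ) / (δ : ℝ) ^ (q - 2) *
          (Real.exp (q + 2) * ((n : ℝ) / r * u)) ^ r := by
        rw [mul_pow, mul_pow, ← Real.exp_nat_mul]
        have hexp : Real.exp (r * (q + 2)) = Real.exp r * Real.exp (q * r) * Real.exp r := by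
          rw [← Real.exp_add, ← Real.exp_add]
          congr 1
          ring
        rw [hexp]
        ring
    _ ≤ _ := by gcongr

theorem uniformProb_stoppingSet_le_div {a δ : ℕ} (hq : 3 ≤ q) (hδ : 1 ≤ δ)
    (ha : 2 * (q : ℝ) * Real.exp (q + 2) ≤ a) (hm : a * δ ≤ m) (S : Finset (BitVec κ))
    (hS : S.card ≤ 2 * δ) (hqδ : q * δ ≤ m) :
    uniformProb (fun H : HashFamily κ q m => ∃ R ⊆ S, R.Nonempty ∧ IsStoppingSet H R) ≤
      2 * ((q - 2).factorial : ℝ) / (δ : ℝ) ^ (q - 2) := by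
  have hqm : q ≤ m := (Nat.le_mul_of_pos_right q hδ).trans hqδ
  have hSm : q * S.card / 2 ≤ m := by
    have h : q * S.card ≤ 2 * (q * δ) := by
      calc q * S.card ≤ q * (2 * δ) := Nat.mul_le_mul_left q hS
        _ = _ := by ring
    omega
  refine (uniformProb_stoppingSet_le (by omega) hqm S hSm).trans ?_
  have hB : (0 : ℝ) ≤ ((q - 2).factorial : ℝ) / (δ : ℝ) ^ (q - 2) := by positivity
  calc _ ≤ ∑ r ∈ Finset.range (S.card + 1),
        ((q - 2).factorial : ℝ) / (δ : ℝ) ^ (q - 2) * (1 / 2) ^ r := by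
        refine Finset.sum_le_sum fun r hr => ?_
        split_ifs with h2
        · exact stoppingSet_term_le hq hδ h2 (Nat.lt_succ_iff.mp (Finset.mem_range.mp hr)) hS
            ha hm
        · positivity
    _ ≤ ((q - 2).factorial : ℝ) / (δ : ℝ) ^ (q - 2) * 2 := by
        rw [← Finset.mul_sum]
        gcongr
        exact sum_geometric_two_le _
    _ = _ := by ring

end StoppingSets

/-! ### The size of the group of quadratic residues -/

section QuadraticResidues

variable {τ N e d : ℕ} {g : QR N}

/-- Modulo a product of two primes, `1` has at most four square roots. -/
theorem card_ker_powMonoidHom_two_le {p p' : ℕ} (hp : p.Prime) (hp' : p'.Prime) (hne : p ≠ p') :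
    Nat.card (powMonoidHom 2 : (ZMod (p * p'))ˣ →* (ZMod (p * p'))ˣ).ker ≤ 4 := by
  classical
  have : Fact p.Prime := ⟨hp⟩
  have : Fact p'.Prime := ⟨hp'⟩
  let φ := ZMod.chineseRemainder ((Nat.coprime_primes hp hp').mpr hne)
  let K := (powMonoidHom 2 : (ZMod (p * p'))ˣ →* (ZMod (p * p'))ˣ).ker
  have hsq : ∀ u : K, φ (u : (ZMod (p * p'))ˣ) * φ (u : (ZMod (p * p'))ˣ) = 1 := by
    intro u
    have hu : (u : (ZMod (p * p'))ˣ) ^ 2 = 1 := u.2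
    rw [← map_mul, ← Units.val_mul, ← sq, hu, Units.val_one, map_one]
  have h1 : ∀ u : K, (φ (u : (ZMod (p * p'))ˣ)).1 = 1 ∨ (φ (u : (ZMod (p * p'))ˣ)).1 = -1 :=
    fun u => mul_self_eq_one_iff.mp (congrArg Prod.fst (hsq u))
  have h2 : ∀ u : K, (φ (u : (ZMod (p * p'))ˣ)).2 = 1 ∨ (φ (u : (ZMod (p * p'))ˣ)).2 = -1 :=
    fun u => mul_self_eq_one_iff.mp (congrArg Prod.snd (hsq u))
  have hinj : Function.Injective fun u : K =>
      (decide ((φ (u : (ZMod (p * p'))ˣ)).1 = 1), decide ((φ (u : (ZMod (p * p'))ˣ)).2 = 1)) := by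
    intro u v huv
    obtain ⟨e1, e2⟩ := Prod.mk.inj huv
    rw [decide_eq_decide] at e1 e2
    refine Subtype.ext (Units.ext (φ.injective (Prod.ext ?_ ?_)))
    · rcases h1 u with h | h
      · rw [h, e1.mp h]
      · rcases h1 v with h' | h'
        · rw [h', e1.mpr h']
        · rw [h, h']
    · rcases h2 u with h | h
      · rw [h, e2.mp h]
      · rcases h2 v with h' | h'
        · rw [h', e2.mpr h']
        · rw [h, h']
  have h := Nat.card_le_card_of_injective _ hinj
  rw [Nat.card_eq_fintype_card (α := Bool × Bool)] at h
  exact h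

theorem IsRSAKey.four_pow_le (hk : IsRSAKey τ N e d g) : 4 ^ τ ≤ 32 * Nat.card (QR N) := by
  have hN := hk.lower
  obtain ⟨p, p', hp, hp', hne, rfl⟩ := hk.factors
  have : NeZero (p * p') := ⟨hk.pos.ne'⟩
  have h1 := Subgroup.card_mul_index
    (powMonoidHom 2 : (ZMod (p * p'))ˣ →* (ZMod (p * p'))ˣ).ker
  rw [Subgroup.index_ker, Nat.card_eq_fintype_card (α := (ZMod (p * p'))ˣ),
    ZMod.card_units_eq_totient, Nat.totient_mul ((Nat.coprime_primes hp hp').mpr hne),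
    Nat.totient_prime hp, Nat.totient_prime hp'] at h1
  have h2 : (p - 1) * (p' - 1) ≤ 4 * Nat.card (QR (p * p')) := by
    rw [← h1]
    exact Nat.mul_le_mul_right _ (card_ker_powMonoidHom_two_le hp hp' hne)
  have h3 : p * p' ≤ (2 * (p - 1)) * (2 * (p' - 1)) := by
    have := hp.two_le
    have := hp'.two_le
    exact Nat.mul_le_mul (by omega) (by omega)
  rw [pow_mul] at hN
  calc 4 ^ τ = (2 ^ 2) ^ τ := by norm_num
    _ ≤ 2 * ((2 * (p - 1)) * (2 * (p' - 1))) := hN.trans (Nat.mul_le_mul_left 2 h3)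
    _ = 8 * ((p - 1) * (p' - 1)) := by ring
    _ ≤ 8 * (4 * Nat.card (QR (p * p'))) := Nat.mul_le_mul_left 8 h2
    _ = _ := by ring

/-- A unit has at most one `e`-th root modulo `N`, and each residue has at most two
representatives with `2τ` bits. -/
theorem IsRSAKey.card_roots_le (hk : IsRSAKey τ N e d g) (y : (ZMod N)ˣ) :
    ((Finset.range (2 ^ (2 * τ))).filter fun t : ℕ => (t : ZMod N) ^ e = y).card ≤ 2 := by
  set s := (Finset.range (2 ^ (2 * τ))).filter fun t : ℕ => (t : ZMod N) ^ e = y with hs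
  have hroot : ∀ t ∈ s, ∀ t' ∈ s, t % N = t' % N := by
    intro t ht t' ht'
    have h := (Finset.mem_filter.mp ht).2
    have h' := (Finset.mem_filter.mp ht').2
    have hunit : ∀ x : ZMod N, x ^ e = y → ∃ u : (ZMod N)ˣ, (u : ZMod N) = x ∧ u ^ e = y := by
      intro x hx
      have hux : IsUnit x := (isUnit_pow_iff hk.prime_e.ne_zero).mp (hx ▸ y.isUnit)
      obtain ⟨u, rfl⟩ := hux
      exact ⟨u, rfl, Units.ext (by rw [Units.val_pow_eq_pow_val, hx])⟩
    obtain ⟨u, hu, hue⟩ := hunit _ h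
    obtain ⟨u', hu', hue'⟩ := hunit _ h'
    have huu : u = u' := hk.pow_injective (hue.trans hue'.symm)
    exact (ZMod.natCast_eq_natCast_iff t t' N).mp (by rw [← hu, ← hu', huu])
  rcases s.eq_empty_or_nonempty with h0 | ⟨t₀, ht₀⟩
  · simp [h0]
  · have hsub : s ⊆ {t₀ % N, t₀ % N + N} := by
      intro t ht
      have hlt := Finset.mem_range.mp (Finset.mem_filter.mp ht).1
      have hmod := Nat.mod_add_div t N
      rw [hroot t ht t₀ ht₀] at hmod
      have hdiv : t / N < 2 := by
        rw [Nat.div_lt_iff_lt_mul hk.pos]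
        exact hlt.trans_le hk.lower
      rw [Finset.mem_insert, Finset.mem_singleton]
      -- `t < 2 ^ (2 * τ) ≤ 2 * N`
      interval_cases h : t / N
      · left; omega
      · right; omega
    exact (Finset.card_le_card hsub).trans Finset.card_le_two

end QuadraticResidues

/-! ### False positives of the purity test -/

section FalsePositives

variable {κ ℓ q m τ N e d : ℕ} {g : QR N}

/-- The XOR of the triples `(k, b k, t k)` with `k ∈ A`. -/
def cellSum (b : BitVec κ → BitVec ℓ) (t : BitVec κ → ℕ) (A : Finset (BitVec κ)) : Cell κ ℓ :=
  ∑ k ∈ A, (⟨k, b k, t k⟩ : Cell κ ℓ)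

theorem cellSum_insert (b : BitVec κ → BitVec ℓ) (t : BitVec κ → ℕ) {A : Finset (BitVec κ)}
    {k : BitVec κ} (hk : k ∉ A) : cellSum b t (insert k A) = ⟨k, b k, t k⟩ + cellSum b t A :=
  Finset.sum_insert hk

theorem keySum_cellSum (b : BitVec κ → BitVec ℓ) (t t' : BitVec κ → ℕ)
    (A : Finset (BitVec κ)) : (cellSum b t A).keySum = (cellSum b t' A).keySum := by
  induction A using Finset.induction with
  | empty => rfl
  | insert k A hk ih =>
    rw [cellSum_insert b t hk, cellSum_insert b t' hk, Cell.keySum_add, Cell.keySum_add, ih]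

theorem valueSum_cellSum (b : BitVec κ → BitVec ℓ) (t t' : BitVec κ → ℕ)
    (A : Finset (BitVec κ)) : (cellSum b t A).valueSum = (cellSum b t' A).valueSum := by
  induction A using Finset.induction with
  | empty => rfl
  | insert k A hk ih =>
    rw [cellSum_insert b t hk, cellSum_insert b t' hk, Cell.valueSum_add, Cell.valueSum_add, ih]

theorem tagSum_cellSum_lt (b : BitVec κ → BitVec ℓ) {t : BitVec κ → ℕ} {n : ℕ}
    (ht : ∀ k, t k < 2 ^ n) (A : Finset (BitVec κ)) : (cellSum b t A).tagSum < 2 ^ n := by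
  induction A using Finset.induction with
  | empty => exact Nat.two_pow_pos n
  | insert k A hk ih =>
    rw [cellSum_insert b t hk, Cell.tagSum_add]
    exact Nat.xor_lt_two_pow (ht k) ih

theorem cellSum_congr {b : BitVec κ → BitVec ℓ} {t t' : BitVec κ → ℕ} {A : Finset (BitVec κ)}
    (h : ∀ k ∈ A, t k = t' k) : cellSum b t A = cellSum b t' A :=
  Finset.sum_congr rfl fun k hk => by rw [h k hk]

theorem tagSum_cellSum_of_mem (b : BitVec κ → BitVec ℓ) (t : BitVec κ → ℕ)
    {A : Finset (BitVec κ)} {k : BitVec κ} (hk : k ∈ A) :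
    (cellSum b t A).tagSum = t k ^^^ (cellSum b t (A.erase k)).tagSum := by
  rw [← Cell.tagSum_add ⟨k, b k, t k⟩, ← cellSum_insert b t (Finset.notMem_erase k A),
    Finset.insert_erase hk]

/-- The tag of `(k, b)` as a function of the random oracle `h` alone. -/
def oracleTag (d : ℕ) (g : QR N) (h : BitVec κ → QR N) (k : BitVec κ) (b : BitVec ℓ) : ℕ :=
  ((tagBase g h k b ^ d : (ZMod N)ˣ) : ZMod N).val

/-- The XOR of the tagged blocks with keys in `A` passes the public test. -/
def FalsePositive (e d : ℕ) (g : QR N) (b : BitVec κ → BitVec ℓ) (A : Finset (BitVec κ))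
    (h : BitVec κ → QR N) : Prop :=
  ((cellSum b (fun k => oracleTag d g h k (b k)) A).tagSum : ZMod N) ^ e =
    (tagBase g h (cellSum b 0 A).keySum (cellSum b 0 A).valueSum : ZMod N)

theorem falsePositive_of_serverPure {ω : Coins κ q m N} {b : BitVec κ → BitVec ℓ}
    {A : Finset (BitVec κ)} (h : serverPure (ω.key e g)
      (∑ k ∈ A, (⟨k, b k, tag (ω.key e g) d k (b k)⟩ : Cell κ ℓ))) :
    FalsePositive e d g b A ω.2 := by
  unfold FalsePositive
  rw [keySum_cellSum b 0 (fun k => oracleTag d g ω.2 k (b k)),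
    valueSum_cellSum b 0 (fun k => oracleTag d g ω.2 k (b k))]
  exact h

theorem tagBase_update_self (h : BitVec κ → QR N) (k : BitVec κ) (x : QR N) (b : BitVec ℓ) :
    tagBase g (Function.update h k x) k b = ((x * g ^ b.toNat : QR N) : (ZMod N)ˣ) := by
  rw [tagBase, Function.update_self]

theorem tagBase_update_of_ne (h : BitVec κ → QR N) {k k' : BitVec κ} (hne : k' ≠ k) (x : QR N)
    (b : BitVec ℓ) : tagBase g (Function.update h k x) k' b = tagBase g h k' b := by
  rw [tagBase, tagBase, Function.update_of_ne hne]

theorem tagBase_update_injective (g : QR N) (h : BitVec κ → QR N) (k : BitVec κ)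
    (b : BitVec ℓ) : Function.Injective fun x => tagBase g (Function.update h k x) k b := by
  intro x y hxy
  simp only [tagBase_update_self] at hxy
  exact mul_right_cancel (Subtype.ext hxy)

/-- Let `k` be the XOR of the keys in `A`.  If `k ∉ A`, the test compares a fixed tag with the
fresh value `h(k)`.  If `k ∈ A`, it is the tag of another key of `A` that is independent of
`h(k)`: given everything else, at most two values of that tag pass the test. -/
theorem uniformProb_falsePositive_le (hk : IsRSAKey τ N e d g) (b : BitVec κ → BitVec ℓ)
    {A : Finset (BitVec κ)} (hA : 2 ≤ A.card) :
    uniformProb (FalsePositive e d g b A) ≤ 64 / 4 ^ τ := by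
  have : NeZero N := ⟨hk.pos.ne'⟩
  have hsize : (4 : ℝ) ^ τ ≤ 32 * Nat.card (QR N) := by exact_mod_cast hk.four_pow_le
  have hcard : (0 : ℝ) < Nat.card (QR N) := by exact_mod_cast Nat.card_pos
  suffices hle : uniformProb (FalsePositive e d g b A) ≤ (2 : ℕ) / Nat.card (QR N) by
    refine hle.trans ?_
    rw [div_le_div_iff₀ hcard (by positivity)]
    push_cast
    linarith
  set k := (cellSum b 0 A).keySum
  set v := (cellSum b 0 A).valueSum
  by_cases hkA : k ∈ A
  · obtain ⟨j, hj, hjk⟩ := Finset.exists_mem_ne (by omega : 1 < A.card) k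
    refine uniformProb_le_of_update _ j 2 fun h => ?_
    have hroots := hk.card_roots_le (tagBase g h k v)
    rw [← Fintype.card_coe, ← Nat.card_eq_fintype_card] at hroots
    let T : QR N → ℕ := fun z =>
      (cellSum b (fun i => oracleTag d g (Function.update h j z) i (b i)) A).tagSum
    have hT : ∀ x : {z // FalsePositive e d g b A (Function.update h j z)},
        T x.1 ∈ (Finset.range (2 ^ (2 * τ))).filter
          fun t : ℕ => (t : ZMod N) ^ e = tagBase g h k v := by
      intro x
      refine Finset.mem_filter.mpr ⟨Finset.mem_range.mpr (tagSum_cellSum_lt b (fun i =>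
        (ZMod.val_lt _).trans hk.upper) A), ?_⟩
      have hx : (T x.1 : ZMod N) ^ e = (tagBase g (Function.update h j x.1) k v : ZMod N) := x.2
      rwa [tagBase_update_of_ne h hjk.symm] at hx
    refine le_trans (Nat.card_le_card_of_injective (fun x => ⟨T x.1, hT x⟩) ?_) hroots
    intro x y hxy
    have hxy' : T x.1 = T y.1 := congrArg Subtype.val hxy
    simp only [T] at hxy'
    rw [tagSum_cellSum_of_mem b _ hj, tagSum_cellSum_of_mem b _ hj] at hxy'
    have hrest : ∀ z : QR N, cellSum b
        (fun i => oracleTag d g (Function.update h j z) i (b i)) (A.erase j) =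
        cellSum b (fun i => oracleTag d g h i (b i)) (A.erase j) := fun z =>
      cellSum_congr fun i hi => by
        rw [oracleTag, oracleTag, tagBase_update_of_ne h (Finset.ne_of_mem_erase hi)]
    rw [hrest, hrest] at hxy'
    have htag := Units.ext (ZMod.val_injective N (Nat.xor_left_injective hxy'))
    have hbase := congrArg (· ^ e) htag
    simp only [hk.pow_pow] at hbase
    exact Subtype.ext (tagBase_update_injective g h j (b j) hbase)
  · refine uniformProb_le_of_update _ k 2 fun h => ?_
    refine le_trans (Finite.card_le_one_iff_subsingleton.mpr ⟨fun x y => ?_⟩) one_le_two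
    have hsum : ∀ z : QR N, cellSum b
        (fun i => oracleTag d g (Function.update h k z) i (b i)) A =
        cellSum b (fun i => oracleTag d g h i (b i)) A := fun z =>
      cellSum_congr fun i hi => by
        rw [oracleTag, oracleTag, tagBase_update_of_ne h (ne_of_mem_of_not_mem hi hkA)]
    have hx := x.2
    have hy := y.2
    unfold FalsePositive at hx hy
    rw [hsum] at hx hy
    exact Subtype.ext (tagBase_update_injective g h k v (Units.ext (hx.symm.trans hy)))

/-- The expected number of pairs of a cell and a set of at least two keys of `S` that are all
hashed to it and give a false positive is at most `m (1 + q / m)^|S|` times the probability of a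
false positive for a fixed set. -/
theorem uniformProb_exists_falsePositive_le (hk : IsRSAKey τ N e d g) (hm : q ≤ m)
    (b : BitVec κ → BitVec ℓ) (S : Finset (BitVec κ)) :
    uniformProb (fun ω : Coins κ q m N => ∃ c, ∃ A ⊆ S, 2 ≤ A.card ∧
      (∀ k ∈ A, ∃ i, ω.1 k i = c) ∧ FalsePositive e d g b A ω.2) ≤
      m * (1 + (q : ℝ) / m) ^ S.card * (64 / 4 ^ τ) := by
  classical
  have : NeZero N := ⟨hk.pos.ne'⟩
  have : Nonempty (Fin q ↪ Fin m) := nonempty_embedding hm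
  have h1 : ∀ ω : Coins κ q m N, (∃ c, ∃ A ⊆ S, 2 ≤ A.card ∧
      (∀ k ∈ A, ∃ i, ω.1 k i = c) ∧ FalsePositive e d g b A ω.2) →
      ∃ x ∈ (Finset.univ : Finset (Fin m)) ×ˢ S.powerset.filter fun A => 2 ≤ A.card,
        (∀ k ∈ x.2, ∃ i, ω.1 k i = x.1) ∧ FalsePositive e d g b x.2 ω.2 := by
    rintro ω ⟨c, A, hA, hcard, h⟩
    exact ⟨(c, A), by simp [hA, hcard], h⟩
  refine (uniformProb_mono h1).trans ((uniformProb_exists_le _ _).trans ?_)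
  have h2 : ∀ x ∈ (Finset.univ : Finset (Fin m)) ×ˢ S.powerset.filter fun A => 2 ≤ A.card,
      uniformProb (fun ω : Coins κ q m N =>
        (∀ k ∈ x.2, ∃ i, ω.1 k i = x.1) ∧ FalsePositive e d g b x.2 ω.2) ≤
        ((q : ℝ) / m) ^ x.2.card * (64 / 4 ^ τ) := by
    rintro ⟨c, A⟩ hx
    have hcard : 2 ≤ A.card :=
      (Finset.mem_filter.mp (Finset.mem_product.mp hx).2).2
    rw [uniformProb_prod (fun H : HashFamily κ q m => ∀ k ∈ A, ∃ i, H k i = c)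
      (FalsePositive e d g b A), uniformProb_forall_mem A fun f : Fin q ↪ Fin m => ∃ i, f i = c]
    gcongr
    · exact uniformProb_nonneg _
    · exact uniformProb_nonneg _
    · exact uniformProb_exists_apply_eq_le hm c
    · exact uniformProb_falsePositive_le hk b hcard
  refine (Finset.sum_le_sum h2).trans ?_
  rw [Finset.sum_product]
  simp only [Finset.sum_const, Finset.card_univ, Fintype.card_fin, nsmul_eq_mul]
  rw [← Finset.sum_mul, ← mul_assoc]
  gcongr
  calc ∑ A ∈ S.powerset.filter (fun A => 2 ≤ A.card), ((q : ℝ) / m) ^ A.card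
      ≤ ∑ A ∈ S.powerset, ((q : ℝ) / m) ^ A.card :=
        Finset.sum_le_sum_of_subset_of_nonneg (Finset.filter_subset _ _)
          fun A _ _ => by positivity
    _ = (1 + (q : ℝ) / m) ^ S.card := by
        rw [add_comm, ← Finset.sum_pow_mul_eq_add_pow]
        simp

end FalsePositives

/-! ### The probability of failure -/

section Failure

variable {κ ℓ q m τ N e d a δ : ℕ} {g : QR N}

theorem uniformProb_badCoins_le (hk : IsRSAKey τ N e d g) (hq : 3 ≤ q) (hδ : 1 ≤ δ)
    (ha : 2 * (q : ℝ) * Real.exp (q + 2) ≤ a) (hm : a * δ ≤ m) (D : Database κ ℓ)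
    {S : Finset (BitVec κ)} (hS : S.card ≤ 2 * δ) :
    uniformProb (BadCoins (m := m) (q := q) e d g D S) ≤
      2 * ((q - 2).factorial : ℝ) / (δ : ℝ) ^ (q - 2) + 64 * Real.exp 1 * m / 4 ^ τ := by
  have : NeZero N := ⟨hk.pos.ne'⟩
  have hδ0 : (0 : ℝ) < δ := by exact_mod_cast hδ
  have hq0 : (0 : ℝ) < q := by exact_mod_cast (by omega : 0 < q)
  have haq : 2 * q ≤ a := by
    have h1 : 1 ≤ Real.exp (q + 2 : ℝ) := Real.one_le_exp (by positivity)
    have h2 := mul_le_mul_of_nonneg_left h1 (by positivity : 0 ≤ 2 * (q : ℝ))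
    have h3 : (2 * q : ℝ) ≤ a := by linarith
    exact_mod_cast h3
  have hqδ : 2 * q * δ ≤ m := (Nat.mul_le_mul_right δ haq).trans hm
  have hqδ' : q * δ ≤ m := (Nat.mul_le_mul_right δ (by omega)).trans hqδ
  have hqm : q ≤ m := (Nat.le_mul_of_pos_right q hδ).trans hqδ'
  have hm0 : (0 : ℝ) < m := by exact_mod_cast (by omega : 0 < m)
  have hload : (1 + (q : ℝ) / m) ^ S.card ≤ Real.exp 1 := by
    calc (1 + (q : ℝ) / m) ^ S.card ≤ Real.exp ((q : ℝ) / m) ^ S.card := by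
          gcongr
          rw [add_comm]
          exact Real.add_one_le_exp _
      _ = Real.exp (S.card * ((q : ℝ) / m)) := (Real.exp_nat_mul _ _).symm
      _ ≤ Real.exp 1 := by
          gcongr
          rw [← mul_div_assoc, div_le_one hm0]
          have h : S.card * q ≤ m := by
            calc S.card * q ≤ 2 * δ * q := Nat.mul_le_mul_right q hS
              _ = 2 * q * δ := by ring
              _ ≤ m := hqδ
          exact_mod_cast h
  unfold BadCoins
  refine (uniformProb_or_le _ _).trans ?_
  rw [add_comm]
  refine add_le_add ?_ ?_
  · exact (uniformProb_fst_le fun H : HashFamily κ q m =>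
      ∃ R ⊆ S, R.Nonempty ∧ IsStoppingSet H R).trans
        (uniformProb_stoppingSet_le_div hq hδ ha hm S hS hqδ')
  · refine (uniformProb_mono ?_).trans
      ((uniformProb_exists_falsePositive_le hk hqm D.block S).trans ?_)
    · rintro ω ⟨c, A, hA, hcard, hc, hpure⟩
      exact ⟨c, A, hA, hcard, hc, falsePositive_of_serverPure hpure⟩
    · calc (m : ℝ) * (1 + (q : ℝ) / m) ^ S.card * (64 / 4 ^ τ)
          ≤ m * Real.exp 1 * (64 / 4 ^ τ) := by gcongr
        _ = _ := by ring

/-- The states before the corruption are honest whatever the random choices are, so a property that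
holds outside `BadCoins` fails with at most the probability of `BadCoins`. -/
theorem one_sub_le_successProb (hk : IsRSAKey τ N e d g) (hqm : q ≤ m) (β : ℕ)
    (prio : BitVec κ → ℝ) {D₀ : Database κ ℓ} {os : List (Op κ ℓ)} (hos : ValidHistory D₀ os)
    {L S : Finset (BitVec κ)} {ε : ℝ}
    (hbad : uniformProb (BadCoins (m := m) (q := q) e d g (finalData D₀ os) S) ≤ ε)
    {P : PublicKey κ q m → PeelRule κ ℓ m → World κ ℓ m → Prop}
    (hP : ∀ (ω : Coins κ q m N) (rule : PeelRule κ ℓ m) (w w' : World κ ℓ m),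
      w.Honest (ω.key e g) d (finalData D₀ os) → Corrupts (ω.key e g) L w w' →
      ¬ BadCoins e d g (finalData D₀ os) S ω → P (ω.key e g) rule w') :
    1 - ε ≤ successProb q e d β g prio D₀ os L P := by
  have : NeZero N := ⟨hk.pos.ne'⟩
  have : Nonempty (Fin q ↪ Fin m) := nonempty_embedding hqm
  refine (sub_le_sub_left hbad 1).trans (one_sub_uniformProb_le fun ω hω rule w hw => ?_)
  exact hP ω rule _ w (run_honest hk ω β prio rule D₀ os hos) hw hω

theorem isCorrect (hk : IsRSAKey τ N e d g) (hq : 3 ≤ q) (hδ : 1 ≤ δ)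
    (ha : 2 * (q : ℝ) * Real.exp (q + 2) ≤ a) (hm : a * δ ≤ m) (hqm : q ≤ m) (β : ℕ)
    (prio : BitVec κ → ℝ) {ε : ℝ}
    (hε : 2 * ((q - 2).factorial : ℝ) / (δ : ℝ) ^ (q - 2) + 64 * Real.exp 1 * m / 4 ^ τ ≤ ε) :
    IsCorrect κ ℓ q m δ β N e d g prio ε := by
  intro D₀ os hos L hL hLδ
  have hbad : ∀ S : Finset (BitVec κ), S.card ≤ 2 * δ →
      uniformProb (BadCoins (m := m) (q := q) e d g (finalData D₀ os) S) ≤ ε := fun S hS =>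
    (uniformProb_badCoins_le hk hq hδ ha hm _ hS).trans hε
  have hbadL := hbad L (by omega)
  refine ⟨fun K' hK' hKδ => ?_, fun k hkD => ⟨?_, ?_⟩, ?_⟩
  · have hbadK := hbad (K' ∪ L) ((Finset.card_union_le _ _).trans (by omega))
    exact ⟨one_sub_le_successProb hk hqm β prio hos hbadK fun ω rule w w' hw hc hω =>
        clientAudit_eq hk hw hc hL hK' hω rule,
      one_sub_le_successProb hk hqm β prio hos hbadK fun ω rule w w' hw hc hω =>
        serverAudit_eq hk hw hc hL hK' hω rule⟩
  · exact one_sub_le_successProb hk hqm β prio hos hbadL fun ω rule w w' hw hc hω =>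
      get_eq hk hw hc hL hω rule hkD
  · exact one_sub_le_successProb hk hqm β prio hos hbadL fun ω rule w w' hw hc hω =>
      delete_eq hk hw hc hL hω β prio rule hkD
  · exact one_sub_le_successProb hk hqm β prio hos hbadL fun ω rule w w' hw hc hω =>
      accountabilityChallenge_eq hk hw hc hL hω rule

end Failure

end DAS

theorem mainTheorem2 (q : ℕ) (hq : 3 ≤ q) :
    ∃ (a : ℕ) (C : ℝ), ∀ (κ ℓ τ δ m β : ℕ), 1 ≤ δ → a * δ ≤ m →
      ∀ (N e d : ℕ) (g : DAS.QR N), DAS.IsRSAKey τ N e d g →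
      ∀ prio : BitVec κ → ℝ,
        DAS.IsCorrect κ ℓ q m δ β N e d g prio
          (C / (δ : ℝ) ^ (q - 2) + C * (m : ℝ) / (4 : ℝ) ^ τ) := by
  obtain ⟨a, ha⟩ := exists_nat_ge (2 * (q : ℝ) * Real.exp (q + 2))
  -- The maximum with `q` ensures `q ≤ m`, so that families of hash functions exist.
  refine ⟨max q a, 2 * ((q - 2).factorial : ℝ) + 64 * Real.exp 1, ?_⟩
  intro κ ℓ τ δ m β hδ hm N e d g hk prio
  have hqm : q ≤ m :=
    (le_max_left q a).trans ((Nat.le_mul_of_pos_right _ hδ).trans hm)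
  refine DAS.isCorrect hk hq hδ ha ((Nat.mul_le_mul_right δ (le_max_right q a)).trans hm) hqm β
    prio ?_
  have h1 : (0 : ℝ) < Real.exp 1 := Real.exp_pos 1
  have h2 : (0 : ℝ) ≤ ((q - 2).factorial : ℝ) := Nat.cast_nonneg _
  gcongr <;> linarith
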